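/- **Problem.** An instance consists of a finite directed acyclic graph $G=(V,E)$ with $n=|V|$ unit-length jobs, a number $M\ge 1$ of identical machines and an integer communication delay $\rho$. A schedule is a finite set of triples (machine $m$, job $v$, time slot $t\in\{1,2,\dots\}$); jobs may be duplicated. It is feasible if every job is processed at least once, every machine processes at most one job per slot, and whenever $v$ is processed on $m$ in slot $t$ and $(u,v)\in E$, then $u$ is processed on $m$ in a slot $<t$ or on another machine in a slot $<t-\rho$. Its length is the largest slot used; $\mathsf{OPT}$ is the minimum length of a feasible schedule. For an induced subgraph $H$, $A_H(v)$ is the set of ancestors of $v$ in $H$ including $v$ (empty if $v\notin H$), $E_H(v)$ is the set of edges induced by $A_H(v)$, $A_H(B)=\bigcup_{v\in B}A_H(v)$, and $E_H(B)$ is the set of edges induced by $A_H(B)$. **Size estimates.** Let $\varepsilon=1/3$, $t=\lceil c/\varepsilon^2\rceil$, where $c,c'$ are constants. To estimate all $|A_H(v)|$, draw $\max(1,\lceil c'\ln n\rceil)$ independent uniform hash functions from a pairwise independent (strongly 2-universal) family $V\to\{1,\dots,N\}$, $N=n^3$. For each hash function keep for each $v$ the $t$ smallest hash values of $A_H(v)$,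 computed in topological order by inserting $v$ and merging the sketches of its predecessors. A sketch gives the value $tN/\ell$, $\ell$ being its largest entry, if it holds $t$ entries, and otherwise its number of entries. The estimate is the median over the hash functions. The sizes $|E_H(v)|$ are estimated in the same way, with hash functions $V\times V\to\{1,\dots,N\}$, $N=(n^2)^3$. Each invocation draws fresh hash functions. **Algorithm ScheduleGeneralGraph$(G)$**, with parameter $\gamma$. 1. While $G$ is non-empty: estimate the numbers of ancestors in the current $G$, and build $V_H$ with a queue initialised with the sources of $G$: remove the first $v$ from the queue, and if its estimate is at most $\frac43\rho$, mark it, add it to $V_H$ and enqueue each successor all of whose predecessors in $G$ are marked. When the queue is empty, record the induced subgraph $H$ on $V_H$ and remove $V_H$ from $G$. 2. For each recorded $H$ in order, while $H\ne\emptyset$: let $B=\mathrm{FindBatch}(H,\gamma)$; list-schedule the sets $A_H(v)$, $v\in B$ (each set, in topological order, is put as one contiguous block on a currently least loaded machine); then insert a delay of $\rho$ on all machines after the latest end time; remove $A_H(B)$ from $H$. FindBatch$(H,\gamma)$: start with $B=\emptyset$; put each $v$ in bucket $K_i$ if its edge estimate lies in $[2^i,2^{i+1})$, and in $K_0$ if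 it is smaller than $2$. While some bucket is non-empty: for each $i$ in decreasing order, sample vertices of $K_i$ uniformly without replacement until $K_i$ is empty or $\max(1,\lceil a\ln n\rceil)$ consecutive samples were stale ($a>0$ a constant); a sampled $v$ is fresh, and is appended to $B$, if $|A_H(v)\setminus A_H(B)|>\gamma|A_H(v)|$ and (unless $E_H(v)=\emptyset$) $|E_H(v)\setminus E_H(B)|>\gamma|E_H(v)|$, and is stale otherwise. Then, with $H'=H\setminus A_H(B)$, estimate all sizes in $H$ and in $H'$ and delete from its bucket every $v$ for which the ratio (estimate in $H'$)/(estimate in $H$) is at most $2\gamma$ for the number of ancestors, or for the number of edges if the edge estimate in $H$ is non-zero. Return $B$. **Theorem.** There are absolute constants $c_0$, $C$, $\rho_0$ such that for every $c\ge c_0$ and every $d\ge 1$ there is $c'_0$ such that for all $c'\ge c'_0$ and all $a>0$ the following holds for all $G$, $M\ge 1$, all integers $\rho\ge\rho_0$ and all hash families as above. With probability at least $1-n^{-d}$, algorithm ScheduleGeneralGraph with $\gamma=1/\sqrt{\ln\rho}$ halts and outputs a feasible schedule of length at most $$C\cdot\frac{\ln\rho}{\ln\ln\rho}\cdot(\mathsf{OPT}+\rho).$$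 -/

import Mathlib

noncomputable section

namespace CommDelay

open Finset
open scoped ENNReal

/-! ## Instances, schedules, optimum -/

section Scheduling

variable {V : Type*}

/-- A precedence graph is acyclic: no directed cycle of positive length (in particular no loop). -/
def Acyclic (G : Digraph V) : Prop :=
  ∀ v, ¬ Relation.TransGen G.Adj v v

/-- A schedule on `M` machines: a finite set of triples `(m, v, t)`, meaning that a copy of job `v`
is processed on machine `m` in the unit time slot `t`. Jobs may be duplicated. -/
abbrev Schedule (V : Type*) (M : ℕ) : Type _ := Finset (Fin M × V × ℕ)

/-- Feasibility with communication delay `ρ`; the time slots are `1, 2, 3, …`. -/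
structure IsFeasible (G : Digraph V) {M : ℕ} (ρ : ℕ) (σ : Schedule V M) : Prop where
  time_pos : ∀ m v t, (m, v, t) ∈ σ → 1 ≤ t
  all_jobs : ∀ v, ∃ m t, (m, v, t) ∈ σ
  one_at_a_time : ∀ m t u v, (m, u, t) ∈ σ → (m, v, t) ∈ σ → u = v
  precedence : ∀ m v t, (m, v, t) ∈ σ → ∀ u, G.Adj u v →
    (∃ t', (m, u, t') ∈ σ ∧ t' < t) ∨ (∃ m' t', m' ≠ m ∧ (m', u, t') ∈ σ ∧ t' + ρ < t)

/-- The makespan (length): the completion time of the last job. -/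
def makespan {M : ℕ} (σ : Schedule V M) : ℕ :=
  σ.sup fun p => p.2.2

/-- The length of an optimal schedule on `M` machines with communication delay `ρ`. -/
def OPT (G : Digraph V) (M ρ : ℕ) : ℕ :=
  sInf {T | ∃ σ : Schedule V M, IsFeasible G ρ σ ∧ makespan σ = T}

end Scheduling

/-! ## Induced subgraphs and ancestors

All subgraphs that occur are induced, and are represented by their vertex sets `S`. -/

section Ancestors

variable {V : Type*} [DecidableEq V]

open Classical in
/-- Immediate predecessors of `v` in the subgraph induced by `S`. -/
def pred (G : Digraph V) (S : Finset V) (v : V) : Finset V :=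
  S.filter fun u => G.Adj u v

open Classical in
/-- Immediate successors of `v` in the subgraph induced by `S`. -/
def succ (G : Digraph V) (S : Finset V) (v : V) : Finset V :=
  S.filter fun w => G.Adj v w

open Classical in
/-- Ancestors of `v`, including `v`, in the subgraph induced by `S` (none if `v ∉ S`). -/
def anc (G : Digraph V) (S : Finset V) (v : V) : Finset V :=
  S.filter fun u => v ∈ S ∧ Relation.ReflTransGen (fun a b => a ∈ S ∧ b ∈ S ∧ G.Adj a b) u v

/-- Ancestors of a set of vertices (listed in `B`). -/
def ancOf (G : Digraph V) (S : Finset V) (B : List V) : Finset V :=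
  B.toFinset.biUnion (anc G S)

open Classical in
/-- Edges of `G` induced by the vertex set `X`. -/
def edgesIn (G : Digraph V) (X : Finset V) : Finset (V × V) :=
  (X ×ˢ X).filter fun e => G.Adj e.1 e.2

/-- The vertices of `X ⊆ S` in a topological order of the subgraph induced by `S`: sorted by number
of ancestors (in an acyclic graph a proper ancestor of `v` has strictly fewer ancestors than `v`). -/
def topoSort (G : Digraph V) (S X : Finset V) : List V :=
  X.toList.mergeSort fun a b => decide (#(anc G S a) ≤ #(anc G S b))

end Ancestors

/-! ## Count-distinct estimator -/

/-- A (strongly) 2-universal family of hash functions from `α` to `{1, …, N}`: for a uniformly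
random member `h` and `x ≠ y`, the pair `(h x, h y)` is uniform on `{1, …, N}²`. -/
structure TwoUniversalFamily (α : Type*) (N : ℕ) where
  carrier : Finset (α → ℕ)
  nonempty : carrier.Nonempty
  mem_range : ∀ h ∈ carrier, ∀ x, h x ∈ Finset.Icc 1 N
  pairwise : ∀ x y, x ≠ y → ∀ i ∈ Finset.Icc 1 N, ∀ j ∈ Finset.Icc 1 N,
    #(carrier.filter fun h => h x = i ∧ h y = j) * N ^ 2 = #carrier

/-- `k` independent uniformly random members of a hash family. -/
def drawHashes {α : Type*} {N : ℕ} (F : TwoUniversalFamily α N) (k : ℕ) : PMF (Fin k → α → ℕ) :=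
  PMF.uniformOfFinset (Fintype.piFinset fun _ : Fin k => F.carrier)
    (Fintype.piFinset_nonempty.2 fun _ => F.nonempty)

/-- The `t` smallest elements of a finite set of numbers. -/
def smallest (t : ℕ) (T : Finset ℕ) : Finset ℕ :=
  T.filter fun x => #(T.filter fun y => y < x) < t

/-- Insert a hash value into a tree that keeps the `t` smallest values. -/
def insertTree (t x : ℕ) (T : Finset ℕ) : Finset ℕ :=
  smallest t (insert x T)

/-- Merge two such trees. -/
def mergeTree (t : ℕ) (T₁ T₂ : Finset ℕ) : Finset ℕ :=
  smallest t (T₁ ∪ T₂)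

/-- The estimate of one tree: `t N / ℓ` with `ℓ` the largest element kept, if the tree is full;
the number of stored values if fewer than `t` values were ever seen. -/
def treeEstimate (t N : ℕ) (T : Finset ℕ) : ℝ :=
  if #T < t then (#T : ℝ) else (t : ℝ) * N / (T.sup id : ℕ)

/-- The median: the entry with index `⌊k/2⌋` (counting from `0`) of the sorted list. -/
def median {k : ℕ} (x : Fin k → ℝ) : ℝ :=
  ((List.ofFn x).mergeSort fun a b => decide (a ≤ b)).getD (k / 2) 0

/-- The accuracy parameter of all estimation procedures. -/
def eps : ℝ := 1 / 3

/-- The size `c / ε²` of the trees. -/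
def treeSize (c : ℝ) : ℕ := ⌈c / eps ^ 2⌉₊

/-- A count `Θ(log n)` with constant `c`. -/
def logCount (c : ℝ) (n : ℕ) : ℕ := max 1 ⌈c * Real.log n⌉₊

/-- What the algorithm fixes besides its input: the constant `c` of the tree size, the constant `c'`
of the number of hash functions, the constant `a` of the number of consecutive stale samples,
and hash families for vertices and for edges, with range the cube of the size of their domain. -/
structure Config (V : Type*) [Fintype V] where
  c : ℝ
  c' : ℝ
  a : ℝ
  hashV : TwoUniversalFamily V (Fintype.card V ^ 3)
  hashE : TwoUniversalFamily (V × V) (Fintype.card (V × V) ^ 3)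

section Estimation

variable {V : Type*} [Fintype V] [DecidableEq V]

/-- For one hash function, the trees of the ancestor sets of all vertices of the subgraph induced
by `S`, computed by merging along a topological order. Vertices outside `S` have an empty tree. -/
def vertexTrees (G : Digraph V) (t : ℕ) (h : V → ℕ) (S : Finset V) : V → Finset ℕ :=
  (topoSort G S S).foldl
    (fun D w => Function.update D w
      ((pred G S w).toList.foldl (fun T v => mergeTree t T (D v)) (insertTree t (h w) ∅)))
    (fun _ => ∅)

/-- For one hash function, the trees of the sets of edges induced by the ancestors of each vertex. -/
def edgeTrees (G : Digraph V) (t : ℕ) (h : V × V → ℕ) (S : Finset V) : V → Finset ℕ :=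
  (topoSort G S S).foldl
    (fun D w => Function.update D w
      ((pred G S w).toList.foldl (fun T v => mergeTree t (insertTree t (h (v, w)) T) (D v)) ∅))
    (fun _ => ∅)

/-- Randomized estimates of the numbers of ancestors of all vertices in the subgraph induced by
`S`; every call draws fresh hash functions. -/
def estimateV (cfg : Config V) (G : Digraph V) (S : Finset V) : PMF (V → ℝ) :=
  (drawHashes cfg.hashV (logCount cfg.c' (Fintype.card V))).map fun h v =>
    median fun i => treeEstimate (treeSize cfg.c) (Fintype.card V ^ 3)
      (vertexTrees G (treeSize cfg.c) (h i) S v)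

/-- Randomized estimates of the numbers of edges induced by the ancestors of all vertices in the
subgraph induced by `S`. -/
def estimateE (cfg : Config V) (G : Digraph V) (S : Finset V) : PMF (V → ℝ) :=
  (drawHashes cfg.hashE (logCount cfg.c' (Fintype.card V))).map fun h v =>
    median fun i => treeEstimate (treeSize cfg.c) (Fintype.card (V × V) ^ 3)
      (edgeTrees G (treeSize cfg.c) (h i) S v)

end Estimation

/-! ## Randomized programs with while loops -/

/-- Randomized computations; the outcome `none` says that some loop ran out of fuel. -/
abbrev Rand (α : Type*) : Type _ := OptionT PMF α

/-- `while cond do body`, cut off after `fuel` iterations. -/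
def whileLoop {σ : Type*} (cond : σ → Prop) (body : σ → Rand σ) : ℕ → σ → Rand σ
  | 0, s => open Classical in if cond s then OptionT.fail else pure s
  | fuel + 1, s => open Classical in
      if cond s then (body s >>= fun s' => whileLoop cond body fuel s') else pure s

/-- The probability that a program (with loops cut off after `fuel` iterations, for each `fuel`)
halts with an output in `A`: the limit, i.e. the supremum, over the cut-off. -/
def outputProb {α : Type*} (prog : ℕ → Rand α) (A : Set α) : ℝ≥0∞ :=
  ⨆ fuel, (prog fuel).run.toOuterMeasure (some '' A)

/-! ## List scheduling -/

section ListScheduling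

variable {V : Type*} [DecidableEq V]

/-- A machine of smallest load. -/
def leastLoaded {M : ℕ} [NeZero M] (load : Fin M → ℕ) : Fin M :=
  Classical.choose (Finite.exists_min load)

/-- Put the jobs of `block`, in this order, on machine `m` in the slots `s + 1, s + 2, …`. -/
def placeBlock {M : ℕ} (m : Fin M) (s : ℕ) (block : List V) : Schedule V M :=
  (block.zipIdx.map fun p => (m, p.1, s + p.2 + 1)).toFinset

/-- Greedy list scheduling of blocks after time `start`: each block in turn goes to a machine of
smallest load. Returns the schedule and the largest load. -/
def listSchedule (M : ℕ) [NeZero M] (start : ℕ) (blocks : List (List V)) : Schedule V M × ℕ :=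
  let r := blocks.foldl
    (fun (st : Schedule V M × (Fin M → ℕ)) block =>
      let m := leastLoaded st.2
      (st.1 ∪ placeBlock m (start + st.2 m) block,
        Function.update st.2 m (st.2 m + block.length)))
    (∅, fun _ => 0)
  (r.1, univ.sup r.2)

end ListScheduling

/-! ## The algorithm -/

section Algorithm

variable {V : Type*} [Fintype V] [DecidableEq V]

/-- `v` is fresh with respect to the batch `B`: more than a `γ`-fraction of its ancestors and, if
there are any, of the edges induced by its ancestors are not already covered by `B`. -/
def Fresh (G : Digraph V) (H : Finset V) (γ : ℝ) (B : List V) (v : V) : Prop :=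
  γ * #(anc G H v) < #(anc G H v \ ancOf G H B) ∧
    ((edgesIn G (anc G H v)).Nonempty →
      γ * #(edgesIn G (anc G H v)) <
        #(edgesIn G (anc G H v) \ edgesIn G (ancOf G H B)))

/-- The index `i` with `2 ^ i ≤ x < 2 ^ (i + 1)`; all `x < 2` belong to the smallest bucket `0`. -/
def bucketIndex (x : ℝ) : ℕ := Nat.log 2 ⌊x⌋₊

/-- Sample from one bucket `K`, uniformly without replacement, until `N` consecutive samples were
stale or the bucket is empty. State: number of consecutive stale samples, bucket, batch. -/
def sampleBucket (G : Digraph V) (H : Finset V) (γ : ℝ) (N : ℕ) (fuel : ℕ)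
    (K : Finset V) (B : List V) : Rand (ℕ × Finset V × List V) :=
  whileLoop (fun st => st.1 < N ∧ st.2.1.Nonempty)
    (fun st => open Classical in
      if hK : st.2.1.Nonempty then do
        let v ← OptionT.lift (PMF.uniformOfFinset st.2.1 hK)
        if Fresh G H γ st.2.2 v then
          pure (0, st.2.1.erase v, st.2.2 ++ [v])
        else
          pure (st.1 + 1, st.2.1.erase v, st.2.2)
      else pure st)
    fuel (0, K, B)

/-- Remove from the buckets all vertices that look stale with respect to `B`. -/
def prune (cfg : Config V) (G : Digraph V) (H : Finset V) (γ : ℝ) (B : List V)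
    (K : ℕ → Finset V) : Rand (ℕ → Finset V) := do
  let H' := H \ ancOf G H B
  let nV ← OptionT.lift (estimateV cfg G H)
  let nE ← OptionT.lift (estimateE cfg G H)
  let nV' ← OptionT.lift (estimateV cfg G H')
  let nE' ← OptionT.lift (estimateE cfg G H')
  pure fun i => open Classical in (K i).filter fun v =>
    ¬ (nV' v / nV v ≤ 2 * γ ∨ (nE v ≠ 0 ∧ nE' v / nE v ≤ 2 * γ))

/-- Find a batch in the subgraph induced by `H`. State of the loop: buckets and batch. -/
def findBatch (cfg : Config V) (G : Digraph V) (γ : ℝ) (fuel : ℕ) (H : Finset V) :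
    Rand (List V) := do
  let N := logCount cfg.a (Fintype.card V)
  let nE ← OptionT.lift (estimateE cfg G H)
  let top := H.sup fun v => bucketIndex (nE v)
  let r ← whileLoop (fun st : (ℕ → Finset V) × List V => ∃ i, (st.1 i).Nonempty)
    (fun st => do
      let st' ← (List.range (top + 1)).reverse.foldlM
        (fun (st : (ℕ → Finset V) × List V) i => do
          let r ← sampleBucket G H γ N fuel (st.1 i) st.2
          pure (Function.update st.1 i r.2.1, r.2.2))
        st
      let K ← prune cfg G H γ st'.2 st'.1
      pure (K, st'.2))
    fuel ((fun i => H.filter fun v => bucketIndex (nE v) = i), [])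
  pure r.2

/-- Schedule the small subgraph induced by `H`, starting after the time stored in the clock.
State: remaining vertices, schedule so far, clock. -/
def scheduleSmallSubgraph (cfg : Config V) (G : Digraph V) (M : ℕ) [NeZero M] (ρ : ℕ) (γ : ℝ)
    (fuel : ℕ) (H : Finset V) (σ : Schedule V M) (clock : ℕ) : Rand (Schedule V M × ℕ) := do
  let r ← whileLoop (fun st : Finset V × Schedule V M × ℕ => st.1.Nonempty)
    (fun st => do
      let B ← findBatch cfg G γ fuel st.1
      let L := listSchedule M st.2.2 (B.map fun v => topoSort G st.1 (anc G st.1 v))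
      pure (st.1 \ ancOf G st.1 B, st.2.1 ∪ L.1, st.2.2 + L.2 + ρ))
    fuel (H, σ, clock)
  pure r.2

/-- Build one small subgraph of the graph induced by `R`, given estimates `nV` of the numbers of
ancestors. State: queue, marked vertices (the vertices of the subgraph). -/
def buildSmall (G : Digraph V) (ρ : ℕ) (nV : V → ℝ) (fuel : ℕ) (R : Finset V) :
    Rand (List V × Finset V) :=
  whileLoop (fun st => st.1 ≠ [])
    (fun st => match st.1 with
      | [] => pure st
      | v :: Q =>
        if nV v ≤ 4 / 3 * (ρ : ℝ) then
          let X := insert v st.2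
          pure (Q ++ ((succ G R v).filter fun w => pred G R w ⊆ X).toList, X)
        else pure (Q, st.2))
    fuel ((R.filter fun v => pred G R v = ∅).toList, ∅)

/-- The list of small subgraphs. State: remaining vertices, small subgraphs in order. -/
def partitionGraph (cfg : Config V) (G : Digraph V) (ρ : ℕ) (fuel : ℕ) :
    Rand (List (Finset V)) := do
  let r ← whileLoop (fun st : Finset V × List (Finset V) => st.1.Nonempty)
    (fun st => do
      let nV ← OptionT.lift (estimateV cfg G st.1)
      let q ← buildSmall G ρ nV fuel st.1
      pure (st.1 \ q.2, st.2 ++ [q.2]))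
    fuel (univ, [])
  pure r.2

/-- The main algorithm, with `γ` as a parameter. -/
def scheduleGeneralGraph (cfg : Config V) (G : Digraph V) (M : ℕ) [NeZero M] (ρ : ℕ) (γ : ℝ)
    (fuel : ℕ) : Rand (Schedule V M) := do
  let Hs ← partitionGraph cfg G ρ fuel
  let r ← Hs.foldlM
    (fun (st : Schedule V M × ℕ) H => scheduleSmallSubgraph cfg G M ρ γ fuel H st.1 st.2)
    (∅, 0)
  pure r.1

end Algorithm

end CommDelay

end

/-! The only random events that matter are the accuracies of the size estimates; once these hold,
the length bound is true for every outcome of the sampling.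

Probability. Keeping the `t` smallest values commutes with unions, so a sketch is exactly the
truncated set of hash values of an ancestor set or of its induced edges (`vertexTrees_eq`,
`edgeTrees_eq`). Pairwise independence, through Chebyshev and a collision bound, makes one sketch
wrong by more than a third with probability at most 1/8 (`TwoUniversalFamily.card_inaccurate`). An
exponential moment then bounds the failure of the median of `k` sketches by (2/3)^k
(`card_majority_bad`). Each loop that draws estimates runs at most n times because a set of vertices
shrinks, so a union bound over polynomially many invocations suffices. The calculus of `HoldsExcept`
does this bookkeeping and yields termination as well.

Length. Compare with any feasible schedule of length T. Volume gives n ≤ M T. A layer takes all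
remaining jobs with at most ρ ancestors, and the others must finish at least ρ slots later
(`IsFeasible.lt_of_lt_card_anc`). Hence (number of layers) · ρ ≤ T + ρ. Each job has at most 2ρ
ancestors within its layer.

Inside a layer, freshness makes the total size of the blocks of a batch at most 1/γ times the number
of jobs it removes. List scheduling therefore costs this amount divided by M, plus 2ρ for one
longest block, plus the inserted delay ρ. A job that survives a batch has lost all but a 4γ-fraction
of its ancestors or of their edges, so the product of the two counts drops by the factor 4γ
(`Shrunk.potential_le`). This product lies between 4γ and 8ρ³, which leaves at most β = O(ln ρ / ln
ln ρ) batches per layer for γ = 1/√(ln ρ).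

Summing over the layers gives length at most T/γ + 3β(T + ρ), and 1/γ = √(ln ρ) is of lower order
than β. -/

namespace CommDelay

open Finset
open scoped ENNReal

universe u

/-! ### Failure probabilities of randomized programs. -/

section FailureBounds

variable {α β : Type u}

/-- Except with probability at most `δ`, the program halts with an output satisfying `Q`. -/
def HoldsExcept (x : Rand α) (δ : ℝ≥0∞) (Q : α → Prop) : Prop :=
  x.run.toOuterMeasure (some '' {a | Q a})ᶜ ≤ δ

theorem toOuterMeasure_le_one (p : PMF α) (s : Set α) : p.toOuterMeasure s ≤ 1 := by
  rw [PMF.toOuterMeasure_apply, ← p.tsum_coe]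
  exact ENNReal.tsum_le_tsum fun a => Set.indicator_le_self s p a

theorem HoldsExcept.mono {x : Rand α} {δ δ' : ℝ≥0∞} {Q Q' : α → Prop}
    (h : HoldsExcept x δ Q) (hδ : δ ≤ δ') (hQ : ∀ a, Q a → Q' a) : HoldsExcept x δ' Q' :=
  (MeasureTheory.measure_mono (Set.compl_subset_compl.2 (Set.image_mono hQ))).trans (h.trans hδ)

theorem HoldsExcept.pure {a : α} {Q : α → Prop} (h : Q a) :
    HoldsExcept (Pure.pure a : Rand α) 0 Q := by
  have : (Pure.pure a : Rand α).run = PMF.pure (some a) := rfl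
  rw [HoldsExcept, this, PMF.toOuterMeasure_pure_apply, if_neg]
  simpa using h

theorem HoldsExcept.lift {p : PMF α} {δ : ℝ≥0∞} {Q : α → Prop}
    (h : p.toOuterMeasure {a | ¬ Q a} ≤ δ) : HoldsExcept (OptionT.lift p : Rand α) δ Q := by
  have : (OptionT.lift p : Rand α).run = p.bind fun a => PMF.pure (some a) := rfl
  rw [HoldsExcept, this, PMF.toOuterMeasure_bind_apply]
  refine le_trans (le_of_eq ?_) h
  rw [PMF.toOuterMeasure_apply]
  refine tsum_congr fun a => ?_
  rw [PMF.toOuterMeasure_pure_apply]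
  by_cases hQ : Q a <;> simp [hQ, Set.indicator]

/-- Union bound. The continuation needs its guarantee only on intermediate results satisfying `Q`.
-/
theorem HoldsExcept.bind {x : Rand α} {f : α → Rand β} {δ δ' : ℝ≥0∞} {Q : α → Prop}
    {R : β → Prop} (hx : HoldsExcept x δ Q) (hf : ∀ a, Q a → HoldsExcept (f a) δ' R) :
    HoldsExcept (x >>= f) (δ + δ') R := by
  have hrun : (x >>= f).run = x.run.bind fun o => match o with
      | some a => (f a).run
      | none => PMF.pure none := by
    rw [OptionT.run_bind]
    change x.run.bind _ = _
    congr 1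
    funext o
    cases o <;> rfl
  unfold HoldsExcept at *
  rw [hrun, PMF.toOuterMeasure_bind_apply]
  -- A good intermediate outcome contributes at most its weight times `δ'`; a bad one, including
  -- `none`, is charged its whole weight.
  calc _ ≤ ∑' o, ((some '' {a | Q a})ᶜ.indicator x.run o + x.run o * δ') := by
        refine ENNReal.tsum_le_tsum fun o => ?_
        by_cases ho : o ∈ some '' {a | Q a}
        · obtain ⟨a, ha, rfl⟩ := ho
          exact le_add_left (mul_le_mul_right (hf a ha) _)
        · rw [Set.indicator_of_mem (Set.mem_compl ho)]
          exact le_add_right (mul_le_of_le_one_right' (toOuterMeasure_le_one _ _))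
    _ ≤ δ + δ' := by
        rw [ENNReal.tsum_add, ENNReal.tsum_mul_right, PMF.tsum_coe, one_mul,
          ← PMF.toOuterMeasure_apply]
        gcongr

theorem HoldsExcept.ite {c : Prop} [Decidable c] {x y : Rand α} {δ : ℝ≥0∞} {Q : α → Prop}
    (hx : c → HoldsExcept x δ Q) (hy : ¬ c → HoldsExcept y δ Q) :
    HoldsExcept (if c then x else y) δ Q := by
  split_ifs with h
  exacts [hx h, hy h]

/-- Loops preserve an invariant; a variant bounds the number of iterations. -/
theorem HoldsExcept.whileLoop {cond : α → Prop} {body : α → Rand α} {δ : ℝ≥0∞}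
    (Inv : α → Prop) (m : α → ℕ) (hpos : ∀ s, Inv s → cond s → 0 < m s)
    (hbody : ∀ s, Inv s → cond s → HoldsExcept (body s) δ fun s' => Inv s' ∧ m s' < m s) :
    ∀ (fuel : ℕ) (s : α), Inv s → m s ≤ fuel →
      HoldsExcept (whileLoop cond body fuel s) (m s * δ) fun s' => Inv s' ∧ ¬ cond s' := by
  intro fuel
  induction fuel with
  | zero =>
    intro s hs hm
    by_cases hc : cond s
    · exact absurd (hpos s hs hc) (by omega)
    · simp only [CommDelay.whileLoop, if_neg hc]
      exact (HoldsExcept.pure ⟨hs, hc⟩).mono zero_le fun _ h => h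
  | succ fuel ih =>
    intro s hs hm
    by_cases hc : cond s
    · simp only [CommDelay.whileLoop, if_pos hc]
      have hms := hpos s hs hc
      -- The first iteration costs `δ`; since the variant drops, the rest costs at most `(m s - 1) *
      -- δ`.
      refine ((hbody s hs hc).bind (δ' := (m s - 1 : ℕ) * δ) fun s' hs' =>
        (ih s' hs'.1 (by omega)).mono ?_ fun _ h => h).mono ?_ fun _ h => h
      · gcongr
        omega
      · rw [show m s = 1 + (m s - 1) by omega]
        simp [add_mul]
    · simp only [CommDelay.whileLoop, if_neg hc]
      exact (HoldsExcept.pure ⟨hs, hc⟩).mono zero_le fun _ h => h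

/-- One sufficiently large cut-off is enough, since `outputProb` is a supremum. Running out of fuel
is already counted in `δ`. -/
theorem le_outputProb {prog : ℕ → Rand α} {A : Set α} {δ : ℝ≥0∞} (fuel : ℕ)
    (h : HoldsExcept (prog fuel) δ (· ∈ A)) : 1 - δ ≤ outputProb prog A := by
  refine le_trans ?_ (le_iSup (fun fuel => (prog fuel).run.toOuterMeasure (some '' A)) fuel)
  rw [tsub_le_iff_right]
  refine le_trans ?_ (add_le_add_right h _)
  refine le_trans ?_ (MeasureTheory.measure_union_le _ _)
  rw [Set.ofPred_mem_eq, Set.union_compl_self, PMF.toOuterMeasure_apply]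
  simp [PMF.tsum_coe]

end FailureBounds

/-! ### Ancestor sets, induced edges and topological order. -/

section AncestorLemmas

variable {V : Type*} {G : Digraph V} {S S' : Finset V} {u v w : V}

theorem mem_pred : u ∈ pred G S v ↔ u ∈ S ∧ G.Adj u v := by
  simp [pred]

theorem mem_succ : u ∈ succ G S v ↔ u ∈ S ∧ G.Adj v u := by
  simp [succ]

theorem Acyclic.not_adj_self (hG : Acyclic G) : ¬ G.Adj v v := fun h => hG v (.single h)

theorem mem_edgesIn {X : Finset V} {e : V × V} :
    e ∈ edgesIn G X ↔ e.1 ∈ X ∧ e.2 ∈ X ∧ G.Adj e.1 e.2 := by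
  simp [edgesIn, and_assoc]

theorem edgesIn_mono {X Y : Finset V} (h : X ⊆ Y) : edgesIn G X ⊆ edgesIn G Y := fun _ he => by
  rw [mem_edgesIn] at *
  exact ⟨h he.1, h he.2.1, he.2.2⟩

theorem card_edgesIn_le (X : Finset V) : #(edgesIn G X) ≤ #X ^ 2 :=
  (card_le_card fun _ he => mem_product.2 ⟨(mem_edgesIn.1 he).1, (mem_edgesIn.1 he).2.1⟩).trans_eq
    (by rw [card_product, sq])

variable [DecidableEq V]

theorem mem_anc : u ∈ anc G S v ↔
    u ∈ S ∧ v ∈ S ∧ Relation.ReflTransGen (fun a b => a ∈ S ∧ b ∈ S ∧ G.Adj a b) u v := by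
  simp [anc]

theorem anc_subset : anc G S v ⊆ S := fun _ h => (mem_anc.1 h).1

theorem self_mem_anc (h : v ∈ S) : v ∈ anc G S v := mem_anc.2 ⟨h, h, .refl⟩

theorem anc_of_notMem (h : v ∉ S) : anc G S v = ∅ :=
  Finset.eq_empty_of_forall_notMem fun _ hu => h (mem_anc.1 hu).2.1

theorem anc_subset_anc (h : u ∈ anc G S v) : anc G S u ⊆ anc G S v := fun _ hw =>
  mem_anc.2 ⟨(mem_anc.1 hw).1, (mem_anc.1 h).2.1, (mem_anc.1 hw).2.2.trans (mem_anc.1 h).2.2⟩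

theorem pred_subset_anc (hv : v ∈ S) : pred G S v ⊆ anc G S v := fun _ hu =>
  mem_anc.2 ⟨(mem_pred.1 hu).1, hv, .single ⟨(mem_pred.1 hu).1, hv, (mem_pred.1 hu).2⟩⟩

theorem anc_mono (h : S' ⊆ S) : anc G S' v ⊆ anc G S v := fun _ hu => by
  obtain ⟨hu, hv, hr⟩ := mem_anc.1 hu
  exact mem_anc.2 ⟨h hu, h hv, hr.lift id fun _ _ hab => ⟨h hab.1, h hab.2.1, hab.2.2⟩⟩

theorem anc_eq_insert (hv : v ∈ S) :
    anc G S v = insert v ((pred G S v).biUnion (anc G S)) := by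
  ext u
  simp only [mem_insert, mem_biUnion]
  constructor
  · intro h
    obtain ⟨hu, -, hr⟩ := mem_anc.1 h
    rcases hr.cases_tail with h | ⟨w, hw, hwv⟩
    · exact .inl h.symm
    · exact .inr ⟨w, mem_pred.2 ⟨hwv.1, hwv.2.2⟩, mem_anc.2 ⟨hu, hwv.1, hw⟩⟩
  · rintro (rfl | ⟨w, hw, hu⟩)
    · exact self_mem_anc hv
    · exact anc_subset_anc (pred_subset_anc hv hw) hu

theorem Acyclic.eq_of_mem_anc (hG : Acyclic G) (huv : u ∈ anc G S v) (hvu : v ∈ anc G S u) :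
    u = v := by
  by_contra hne
  have hadj : ∀ {a b}, Relation.ReflTransGen (fun a b => a ∈ S ∧ b ∈ S ∧ G.Adj a b) a b →
      Relation.ReflTransGen G.Adj a b := fun h => h.lift id fun _ _ h => h.2.2
  have h1 := hadj (mem_anc.1 huv).2.2
  have h2 := hadj (mem_anc.1 hvu).2.2
  rcases Relation.reflTransGen_iff_eq_or_transGen.1 h1 with h | h
  · exact hne h.symm
  · exact hG u (h.trans_left h2)

theorem Acyclic.card_anc_lt (hG : Acyclic G) (huv : u ∈ anc G S v) (hne : u ≠ v) :
    #(anc G S u) < #(anc G S v) :=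
  Finset.card_lt_card ⟨anc_subset_anc huv, fun h =>
    hne (hG.eq_of_mem_anc huv (h (self_mem_anc (mem_anc.1 huv).2.1)))⟩

theorem Acyclic.card_anc_lt_of_pred (hG : Acyclic G) (hv : v ∈ S) (h : u ∈ pred G S v) :
    #(anc G S u) < #(anc G S v) :=
  hG.card_anc_lt (pred_subset_anc hv h) fun h' => hG.not_adj_self (h' ▸ (mem_pred.1 h).2)

theorem edgesIn_anc (hw : w ∈ S) :
    edgesIn G (anc G S w) =
      (pred G S w).biUnion fun v => insert (v, w) (edgesIn G (anc G S v)) := by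
  ext ⟨a, b⟩
  simp only [mem_edgesIn, mem_biUnion, mem_insert, Prod.mk.injEq]
  constructor
  · rintro ⟨ha, hb, hab⟩
    have hmem : a ∈ S ∧ b ∈ S := ⟨anc_subset ha, anc_subset hb⟩
    rw [anc_eq_insert hw, mem_insert, mem_biUnion] at hb
    rcases hb with rfl | ⟨v, hv, hb⟩
    · exact ⟨a, mem_pred.2 ⟨hmem.1, hab⟩, .inl ⟨rfl, rfl⟩⟩
    · exact ⟨v, hv, .inr ⟨anc_subset_anc hb
        (pred_subset_anc hmem.2 (mem_pred.2 ⟨hmem.1, hab⟩)), hb, hab⟩⟩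
  · rintro ⟨v, hv, ⟨rfl, rfl⟩ | ⟨ha, hb, hab⟩⟩
    · exact ⟨pred_subset_anc hw hv, self_mem_anc hw, (mem_pred.1 hv).2⟩
    · have := anc_subset_anc (pred_subset_anc hw hv)
      exact ⟨this ha, this hb, hab⟩

theorem mem_ancOf {B : List V} : u ∈ ancOf G S B ↔ ∃ v ∈ B, u ∈ anc G S v := by
  simp [ancOf]

theorem ancOf_subset {B : List V} : ancOf G S B ⊆ S := fun _ h => by
  obtain ⟨v, -, hv⟩ := mem_ancOf.1 h
  exact anc_subset hv

theorem ancOf_mono {B B' : List V} (h : B ⊆ B') : ancOf G S B ⊆ ancOf G S B' := fun _ hu => by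
  obtain ⟨v, hv, huv⟩ := mem_ancOf.1 hu
  exact mem_ancOf.2 ⟨v, h hv, huv⟩

theorem anc_sdiff_subset (B : List V) :
    anc G (S \ ancOf G S B) v ⊆ anc G S v \ ancOf G S B := fun _ hu =>
  mem_sdiff.2 ⟨anc_mono sdiff_subset hu, (mem_sdiff.1 (anc_subset hu)).2⟩

/-- Only an inclusion: an edge from a covered to an uncovered job is not covered, yet it disappears
with its tail. -/
theorem edgesIn_anc_sdiff_subset (B : List V) :
    edgesIn G (anc G (S \ ancOf G S B) v) ⊆
      edgesIn G (anc G S v) \ edgesIn G (ancOf G S B) := fun e he => by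
  have h1 := (mem_edgesIn.1 he).1
  exact mem_sdiff.2 ⟨edgesIn_mono (anc_mono sdiff_subset) he, fun h =>
    (mem_sdiff.1 (anc_subset h1)).2 (mem_edgesIn.1 h).1⟩

theorem mem_topoSort {X : Finset V} : v ∈ topoSort G S X ↔ v ∈ X := by
  simp [topoSort]

theorem length_topoSort (X : Finset V) : (topoSort G S X).length = #X := by
  simp [topoSort]

theorem pairwise_topoSort (X : Finset V) :
    (topoSort G S X).Pairwise fun a b => #(anc G S a) ≤ #(anc G S b) := by
  refine (List.pairwise_mergeSort (le := fun a b => decide (#(anc G S a) ≤ #(anc G S b)))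
    ?_ ?_ X.toList).imp fun h => of_decide_eq_true h
  · intro a b c hab hbc
    simp only [decide_eq_true_eq] at *
    omega
  · intro a b
    simp only [Bool.or_eq_true, decide_eq_true_eq]
    omega

end AncestorLemmas

/-! ### Sketches are truncated sets of hash values. -/

section Trees

theorem mem_smallest {t x : ℕ} {T : Finset ℕ} :
    x ∈ smallest t T ↔ x ∈ T ∧ #(T.filter (· < x)) < t := by
  simp [smallest]

/-- If truncation loses an element below `x`, the least lost one has `t` elements below it, and all
of these are kept. Hence truncation never changes whether fewer than `t` elements lie below `x`,
which is why it commutes with unions. -/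
theorem filter_lt_smallest (t x : ℕ) (X : Finset ℕ) :
    (smallest t X).filter (· < x) = X.filter (· < x) ∨
      t ≤ #((smallest t X).filter (· < x)) := by
  by_cases h : ∃ y ∈ X, y < x ∧ y ∉ smallest t X
  · right
    classical
    have hP : ∃ y, y ∈ X ∧ y < x ∧ y ∉ smallest t X := h
    obtain ⟨hy, hyx, hys⟩ := Nat.find_spec hP
    set y := Nat.find hP
    have hcard : t ≤ #(X.filter (· < y)) := by
      by_contra hlt
      exact hys (mem_smallest.2 ⟨hy, by omega⟩)
    refine hcard.trans (card_le_card fun z hz => ?_)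
    obtain ⟨hzX, hzy⟩ := mem_filter.1 hz
    refine mem_filter.2 ⟨?_, hzy.trans hyx⟩
    by_contra hzs
    exact Nat.find_min hP hzy ⟨hzX, hzy.trans hyx, hzs⟩
  · left
    push Not at h
    ext z
    simp only [mem_filter]
    exact ⟨fun hz => ⟨(mem_smallest.1 hz.1).1, hz.2⟩, fun hz => ⟨h z hz.1 hz.2, hz.2⟩⟩

theorem smallest_union (t : ℕ) (X Y : Finset ℕ) :
    smallest t (smallest t X ∪ Y) = smallest t (X ∪ Y) := by
  have key : ∀ x, #((smallest t X ∪ Y).filter (· < x)) < t ↔ #((X ∪ Y).filter (· < x)) < t := by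
    intro x
    simp only [filter_union]
    rcases filter_lt_smallest t x X with h | h
    · rw [h]
    · have h1 := card_le_card (subset_union_left (s₁ := (smallest t X).filter (· < x))
        (s₂ := Y.filter (· < x)))
      have h2 : #((smallest t X).filter (· < x)) ≤ #(X.filter (· < x)) :=
        card_le_card (filter_subset_filter _ (filter_subset _ _))
      have h3 := card_le_card (subset_union_left (s₁ := X.filter (· < x))
        (s₂ := Y.filter (· < x)))
      omega
  ext x
  rw [mem_smallest, mem_smallest, key]
  refine and_congr_left fun hx => ?_
  simp only [mem_union]
  refine or_congr_left' fun _ => ⟨fun h => (mem_smallest.1 h).1, fun h => mem_smallest.2 ⟨h, ?_⟩⟩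
  refine lt_of_le_of_lt (card_le_card (filter_subset_filter _ subset_union_left)) hx

theorem mergeTree_smallest (t : ℕ) (X Y : Finset ℕ) :
    mergeTree t (smallest t X) (smallest t Y) = smallest t (X ∪ Y) := by
  rw [mergeTree, smallest_union, union_comm, smallest_union, union_comm]

theorem insertTree_smallest (t x : ℕ) (X : Finset ℕ) :
    insertTree t x (smallest t X) = smallest t (insert x X) := by
  rw [insertTree, insert_eq, union_comm, smallest_union, union_comm, ← insert_eq]

theorem smallest_empty (t : ℕ) : smallest t ∅ = ∅ := rfl

variable {V : Type*} [DecidableEq V] {G : Digraph V}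

/-- Values computed along a topological order from the values of the predecessors. -/
theorem foldl_update_topological {β : Type*} (hG : Acyclic G) (S : Finset V) (T : V → β)
    (step : (V → β) → V → β)
    (hstep : ∀ D w, w ∈ S → (∀ u ∈ pred G S w, D u = T u) → step D w = T w) :
    ∀ (l : List V) (D : V → β), (∀ w ∈ l, w ∈ S) →
      l.Pairwise (fun a b => #(anc G S a) ≤ #(anc G S b)) →
      (∀ w ∈ l, ∀ u ∈ pred G S w, u ∈ l ∨ D u = T u) →
      ∀ v, (v ∈ l ∨ D v = T v) →
        l.foldl (fun D w => Function.update D w (step D w)) D v = T v := by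
  intro l
  induction l with
  | nil => simp
  | cons w l ih =>
    intro D hS hl hpred v hv
    rw [List.pairwise_cons] at hl
    have hw : step D w = T w := by
      refine hstep D w (hS w (by simp)) fun u hu => ?_
      rcases hpred w (by simp) u hu with h | h
      · have hlt := hG.card_anc_lt_of_pred (hS w (by simp)) hu
        rcases List.mem_cons.1 h with rfl | h
        · omega
        · exact absurd (hl.1 u h) (by omega)
      · exact h
    have hD : ∀ u, (u ∈ w :: l ∨ D u = T u) → u ∈ l ∨ Function.update D w (step D w) u = T u := by
      intro u hu
      by_cases huw : u = w
      · subst huw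
        right
        simpa using hw
      · rcases hu with h | h
        · exact .inl ((List.mem_cons.1 h).resolve_left huw)
        · right
          simpa [huw] using h
    rw [List.foldl_cons]
    exact ih _ (fun x hx => hS x (by simp [hx])) hl.2
      (fun x hx u hu => hD u (hpred x (by simp [hx]) u hu)) v (hD v hv)

theorem vertexTrees_eq (hG : Acyclic G) (t : ℕ) (h : V → ℕ) (S : Finset V) (v : V) :
    vertexTrees G t h S v = smallest t ((anc G S v).image h) := by
  refine foldl_update_topological hG S (fun v => smallest t ((anc G S v).image h))
    (fun D w => (pred G S w).toList.foldl (fun T v => mergeTree t T (D v)) (insertTree t (h w) ∅))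
    ?_ _ _ (fun w hw => mem_topoSort.1 hw) (pairwise_topoSort S)
    (fun w _ u hu => .inl (mem_topoSort.2 (mem_pred.1 hu).1)) v ?_
  · intro D w hw hD
    have key : ∀ (l : List V) (X : Finset ℕ), (∀ u ∈ l, u ∈ pred G S w) →
        l.foldl (fun T v => mergeTree t T (D v)) (smallest t X) =
          smallest t (X ∪ l.toFinset.biUnion fun v => (anc G S v).image h) := by
      intro l
      induction l with
      | nil => simp
      | cons v l ih =>
        intro X hl
        rw [List.foldl_cons, hD v (hl v (by simp)), mergeTree_smallest,
          ih _ fun u hu => hl u (by simp [hu])]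
        simp [union_assoc]
    rw [← smallest_empty t, insertTree_smallest, key _ _ fun u hu => by simpa using hu]
    rw [anc_eq_insert hw, image_insert, biUnion_image, toList_toFinset]
    congr 1
  · by_cases hv : v ∈ S
    · exact .inl (mem_topoSort.2 hv)
    · right
      simp [anc_of_notMem hv, smallest_empty]

theorem edgeTrees_eq (hG : Acyclic G) (t : ℕ) (h : V × V → ℕ) (S : Finset V) (v : V) :
    edgeTrees G t h S v = smallest t ((edgesIn G (anc G S v)).image h) := by
  refine foldl_update_topological hG S (fun v => smallest t ((edgesIn G (anc G S v)).image h))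
    (fun D w => (pred G S w).toList.foldl
      (fun T v => mergeTree t (insertTree t (h (v, w)) T) (D v)) ∅)
    ?_ _ _ (fun w hw => mem_topoSort.1 hw) (pairwise_topoSort S)
    (fun w _ u hu => .inl (mem_topoSort.2 (mem_pred.1 hu).1)) v ?_
  · intro D w hw hD
    have key : ∀ (l : List V) (X : Finset ℕ), (∀ u ∈ l, u ∈ pred G S w) →
        l.foldl (fun T v => mergeTree t (insertTree t (h (v, w)) T) (D v)) (smallest t X) =
          smallest t (X ∪ l.toFinset.biUnion fun v =>
            insert (h (v, w)) ((edgesIn G (anc G S v)).image h)) := by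
      intro l
      induction l with
      | nil => simp
      | cons v l ih =>
        intro X hl
        rw [List.foldl_cons, hD v (hl v (by simp)), insertTree_smallest, mergeTree_smallest,
          ih _ fun u hu => hl u (by simp [hu])]
        congr 1
        ext x
        simp
    have := key (pred G S w).toList ∅ fun u hu => by simpa using hu
    rw [smallest_empty] at this
    rw [this, edgesIn_anc hw, biUnion_image, toList_toFinset, empty_union]
    simp only [image_insert]
  · by_cases hv : v ∈ S
    · exact .inl (mem_topoSort.2 hv)
    · right
      have : edgesIn G ∅ = ∅ := by ext; simp [mem_edgesIn]
      simp [anc_of_notMem hv, smallest_empty, this]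

end Trees

/-- `x` estimates `s` up to a factor `1 ± 1/3`. -/
def Accurate (x : ℝ) (s : ℕ) : Prop := 2 / 3 * (s : ℝ) ≤ x ∧ x ≤ 4 / 3 * (s : ℝ)

/-! ### From hash value counts to the accuracy of one sketch. -/

section Trees

theorem le_card_smallest {t : ℕ} {T : Finset ℕ} (h : t ≤ #T) : t ≤ #(smallest t T) := by
  by_contra hlt
  obtain ⟨x, hx, hxs⟩ : ∃ x ∈ T, x ∉ smallest t T := by
    by_contra hall
    push Not at hall
    have := card_le_card (show T ⊆ smallest t T from hall)
    omega
  have hx' : t ≤ #(T.filter (· < x)) := by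
    by_contra h'
    exact hxs (mem_smallest.2 ⟨hx, by omega⟩)
  have hle : #((smallest t T).filter (· < x)) ≤ #(smallest t T) := card_filter_le _ _
  rcases filter_lt_smallest t x T with h' | h'
  · rw [h'] at hle
    omega
  · omega

theorem smallest_eq_self {t : ℕ} {T : Finset ℕ} (h : #T < t) : smallest t T = T := by
  ext x
  rw [mem_smallest, and_iff_left_iff_imp]
  exact fun _ => (card_filter_le _ _).trans_lt h

/-- With s = #A and largest kept value ℓ, the estimate tN/ℓ exceeds 4s/3 exactly when ℓ < 3tN/(4s),
and is below 2s/3 exactly when ℓ > 3tN/(2s). The first puts `t` values below the low threshold, the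
second fewer than `t` below the high one. A high threshold of at least N needs no hypothesis, as ℓ ≤
N. -/
theorem accurate_treeEstimate {α : Type*} [DecidableEq α] {A : Finset α} {h : α → ℕ} {N t : ℕ}
    (hN : 0 < N) (ht : 0 < t) (hr : ∀ x, h x ∈ Icc 1 N) (hinj : Set.InjOn h A)
    (hlow : t ≤ #A → #(A.filter fun x => h x ≤ ⌊3 * t * N / (4 * #A : ℝ)⌋₊) < t)
    (hhigh : t ≤ #A → 3 * t * N / (2 * #A : ℝ) < N →
      t ≤ #(A.filter fun x => h x ≤ ⌊3 * t * N / (2 * #A : ℝ)⌋₊)) :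
    Accurate (treeEstimate t N (smallest t (A.image h))) #A := by
  have hcard : #(A.image h) = #A := card_image_of_injOn hinj
  have hfilter : ∀ τ, #(A.filter fun x => h x ≤ τ) = #((A.image h).filter (· ≤ τ)) := by
    intro τ
    rw [filter_image, card_image_of_injOn]
    exact hinj.mono fun x hx => (mem_filter.1 (mem_coe.1 hx)).1
  by_cases hs : #A < t
  · rw [smallest_eq_self (by omega), treeEstimate, if_pos (by omega), hcard]
    have : (0 : ℝ) ≤ #A := by positivity
    constructor <;> linarith
  · push Not at hs
    have hle : t ≤ #(smallest t (A.image h)) := le_card_smallest (by omega)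
    rw [treeEstimate, if_neg (by omega)]
    obtain ⟨l, hl, hl'⟩ := Finset.exists_mem_eq_sup (smallest t (A.image h))
      (card_pos.1 (by omega)) id
    rw [hl']
    simp only [id]
    obtain ⟨hlA, hlt⟩ := mem_smallest.1 hl
    obtain ⟨x, -, rfl⟩ := mem_image.1 hlA
    obtain ⟨h1, hxN⟩ := mem_Icc.1 (hr x)
    have hpos : (0 : ℝ) < h x := by exact_mod_cast h1
    have hA : (0 : ℝ) < #A := by exact_mod_cast (by omega : 0 < #A)
    constructor
    · by_contra hlt'
      push Not at hlt'
      rw [div_lt_iff₀ hpos] at hlt'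
      have hbig : 3 * t * N / (2 * #A : ℝ) < h x := by
        rw [div_lt_iff₀ (by positivity)]
        linarith
      have h3 := hhigh hs (hbig.trans_le (by exact_mod_cast hxN))
      rw [hfilter] at h3
      have h4 : ⌊3 * t * N / (2 * #A : ℝ)⌋₊ < h x := (Nat.floor_lt (by positivity)).2 hbig
      have h5 := card_le_card (show (A.image h).filter (· ≤ ⌊3 * t * N / (2 * #A : ℝ)⌋₊) ⊆
        (A.image h).filter (· < h x) from fun y hy => mem_filter.2
          ⟨(mem_filter.1 hy).1, (mem_filter.1 hy).2.trans_lt h4⟩)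
      omega
    · by_contra hlt'
      push Not at hlt'
      rw [lt_div_iff₀ hpos] at hlt'
      have h4 : h x ≤ ⌊3 * t * N / (4 * #A : ℝ)⌋₊ := by
        refine Nat.le_floor ?_
        rw [le_div_iff₀ (by positivity)]
        linarith
      have h3 := hlow hs
      rw [hfilter] at h3
      have h5 := card_le_card (show smallest t (A.image h) ⊆
        (A.image h).filter (· ≤ ⌊3 * t * N / (4 * #A : ℝ)⌋₊) from fun y hy => mem_filter.2
          ⟨(mem_smallest.1 hy).1, ((le_sup (f := id) hy).trans_eq hl').trans h4⟩)
      omega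

end Trees

/-! ### Collisions and second moments for pairwise independent hashing. -/

section Hashing

variable {α : Type*} {N : ℕ} (F : TwoUniversalFamily α N)

theorem TwoUniversalFamily.card_rect {x y : α} (hxy : x ≠ y) {P Q : Finset ℕ}
    (hP : P ⊆ Icc 1 N) (hQ : Q ⊆ Icc 1 N) :
    #(F.carrier.filter fun h => h x ∈ P ∧ h y ∈ Q) * N ^ 2 = #P * #Q * #F.carrier := by
  rw [card_eq_sum_card_fiberwise (f := fun h => (h x, h y)) (t := P ×ˢ Q), sum_mul,
    sum_congr rfl (g := fun _ => #F.carrier), sum_const, card_product, smul_eq_mul]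
  · rintro ⟨i, j⟩ hij
    obtain ⟨hi, hj⟩ := mem_product.1 hij
    rw [← F.pairwise x y hxy i (hP hi) j (hQ hj), filter_filter]
    congr 2
    refine filter_congr fun h _ => ?_
    simp only [Prod.mk.injEq]
    constructor
    · exact fun h => h.2
    · rintro ⟨rfl, rfl⟩
      exact ⟨⟨hi, hj⟩, rfl, rfl⟩
  · intro h hh
    simpa using (mem_filter.1 (mem_coe.1 hh)).2

theorem TwoUniversalFamily.card_collision {x y : α} (hxy : x ≠ y) (hN : 0 < N) :
    #(F.carrier.filter fun h => h x = h y) * N = #F.carrier := by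
  have : #(F.carrier.filter fun h => h x = h y) * N ^ 2 = N * #F.carrier := by
    rw [card_eq_sum_card_fiberwise (f := fun h => h x) (t := Icc 1 N), sum_mul,
      sum_congr rfl (g := fun _ => #F.carrier), sum_const, Nat.card_Icc, smul_eq_mul]
    · rfl
    · intro i hi
      rw [← F.pairwise x y hxy i hi i hi, filter_filter]
      congr 2
      refine filter_congr fun h _ => ?_
      constructor
      · rintro ⟨h1, h2⟩
        exact ⟨h2, h1 ▸ h2⟩
      · rintro ⟨h1, h2⟩
        exact ⟨h1.trans h2.symm, h1⟩
    · intro h hh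
      exact mem_coe.2 (F.mem_range h (mem_filter.1 (mem_coe.1 hh)).1 x)
  refine Nat.eq_of_mul_eq_mul_left hN ?_
  rw [← this]
  ring

variable [DecidableEq α]

theorem TwoUniversalFamily.card_not_injOn (hN : 0 < N) (A : Finset α)
    (P : (α → ℕ) → Prop) [DecidablePred P] (hP : ∀ h, P h → ¬ Set.InjOn h A) :
    2 * N * #(F.carrier.filter P) ≤ (#A * #A - #A) * #F.carrier := by
  have h1 : ∑ p ∈ A.offDiag, #(F.carrier.filter fun h => h p.1 = h p.2) * N =
      (#A * #A - #A) * #F.carrier := by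
    rw [sum_congr rfl (g := fun _ => #F.carrier), sum_const, offDiag_card, smul_eq_mul]
    exact fun p hp => F.card_collision (mem_offDiag.1 hp).2.2 hN
  rw [← h1, ← sum_mul, mul_right_comm]
  refine Nat.mul_le_mul_right _ ?_
  have h2 : ∑ p ∈ A.offDiag, #(F.carrier.filter fun h => h p.1 = h p.2) =
      ∑ h ∈ F.carrier, #(A.offDiag.filter fun p => h p.1 = h p.2) := by
    simp only [card_filter]
    exact sum_comm
  have h3 : 2 * #(F.carrier.filter P) ≤
      ∑ h ∈ F.carrier.filter P, #(A.offDiag.filter fun p => h p.1 = h p.2) := by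
    rw [mul_comm]
    refine card_nsmul_le_sum (F.carrier.filter P)
      (fun h => #(A.offDiag.filter fun p => h p.1 = h p.2)) 2 fun h hh => ?_
    have hni := hP h (mem_filter.1 hh).2
    simp only [Set.InjOn] at hni
    push Not at hni
    obtain ⟨x, hx, y, hy, hxy, hne⟩ := hni
    -- A collision is counted as two ordered pairs; the resulting factor 2 is what brings the
    -- collision probability down to 1/8 for small `α`.
    rw [← card_pair (show (x, y) ≠ (y, x) by simp [hne])]
    refine card_le_card fun p hp => ?_
    simp only [mem_insert, mem_singleton] at hp
    rcases hp with rfl | rfl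
    · exact mem_filter.2 ⟨mem_offDiag.2 ⟨hx, hy, hne⟩, hxy⟩
    · exact mem_filter.2 ⟨mem_offDiag.2 ⟨hy, hx, hne.symm⟩, hxy.symm⟩
  rw [h2]
  exact h3.trans (sum_le_sum_of_subset (filter_subset P _))

/-- Second moment of the number of elements of `A` with hash value at most `τ`. -/
theorem TwoUniversalFamily.sum_sq_le (hα : Nontrivial α) (hN : 0 < N) (A : Finset α) {τ : ℕ}
    (hτ : τ ≤ N) :
    ∑ h ∈ F.carrier, ((#(A.filter fun x => h x ≤ τ) : ℝ) - #A * τ / N) ^ 2 ≤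
      #F.carrier * (#A * τ / N) := by
  have hN' : (0 : ℝ) < N := by exact_mod_cast hN
  set p : ℝ := τ / N with hp
  set K : ℝ := ((#F.carrier : ℕ) : ℝ) with hK
  have hsub : Icc 1 τ ⊆ Icc 1 N := Icc_subset_Icc_right hτ
  have hmem : ∀ h ∈ F.carrier, ∀ x, h x ≤ τ ↔ h x ∈ Icc 1 τ := fun h hh x => by
    have := mem_Icc.1 (F.mem_range h hh x)
    simp only [mem_Icc]
    omega
  have h2 : ∀ x y, x ≠ y →
      (#(F.carrier.filter fun h => h x ≤ τ ∧ h y ≤ τ) : ℝ) = K * p ^ 2 := by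
    intro x y hxy
    have := F.card_rect hxy hsub hsub
    rw [filter_congr fun h hh => and_congr (hmem h hh x) (hmem h hh y)]
    rw [Nat.card_Icc, Nat.add_sub_cancel] at this
    have h' : (#(F.carrier.filter fun h => h x ∈ Icc 1 τ ∧ h y ∈ Icc 1 τ) : ℝ) * N ^ 2 =
      τ * τ * K := by rw [hK]; exact_mod_cast this
    rw [hp, div_pow, mul_div_assoc', eq_div_iff (by positivity), h']
    ring
  have h1 : ∀ x, (#(F.carrier.filter fun h => h x ≤ τ) : ℝ) = K * p := by
    intro x
    -- The law of a single value is a marginal of the law of a pair, so a second point is needed.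
    obtain ⟨y, hy⟩ := exists_ne x
    have := F.card_rect hy.symm hsub (subset_refl _)
    rw [filter_congr fun h hh => hmem h hh x]
    rw [filter_congr (q := fun h => h x ∈ Icc 1 τ)
      fun h hh => and_iff_left (F.mem_range h hh y)] at this
    rw [Nat.card_Icc, Nat.add_sub_cancel, Nat.card_Icc, Nat.add_sub_cancel] at this
    have h' : (#(F.carrier.filter fun h => h x ∈ Icc 1 τ) : ℝ) * N ^ 2 =
      τ * N * K := by rw [hK]; exact_mod_cast this
    rw [hp, mul_div_assoc', eq_div_iff (by positivity)]
    have : (N : ℝ) * (#(F.carrier.filter fun h => h x ∈ Icc 1 τ) * N) = N * (K * τ) := by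
      linarith
    exact mul_left_cancel₀ hN'.ne' this
  have s1 : ∑ h ∈ F.carrier, (#(A.filter fun x => h x ≤ τ) : ℝ) = #A * (K * p) := by
    rw [← nsmul_eq_mul, ← sum_const, ← sum_congr rfl fun x _ => h1 x]
    simp only [card_filter, Nat.cast_sum]
    exact sum_comm
  have s2 : ∑ h ∈ F.carrier, (#(A.filter fun x => h x ≤ τ) : ℝ) ^ 2 =
      #A * (K * p) + (#A * #A - #A) * (K * p ^ 2) := by
    have e1 : ∀ h : α → ℕ, (#(A.filter fun x => h x ≤ τ) : ℝ) ^ 2 =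
        ∑ q ∈ A ×ˢ A, if h q.1 ≤ τ ∧ h q.2 ≤ τ then (1 : ℝ) else 0 := by
      intro h
      rw [sq, card_filter, Nat.cast_sum, sum_mul_sum, ← sum_product']
      refine sum_congr rfl fun q _ => ?_
      by_cases h1 : h q.1 ≤ τ <;> by_cases h2 : h q.2 ≤ τ <;> simp [h1, h2]
    have e2 : ∀ q : α × α, ∑ h ∈ F.carrier, (if h q.1 ≤ τ ∧ h q.2 ≤ τ then (1 : ℝ) else 0) =
        #(F.carrier.filter fun h => h q.1 ≤ τ ∧ h q.2 ≤ τ) := by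
      intro q
      rw [card_filter]
      push_cast
      rfl
    simp only [e1]
    rw [sum_comm]
    simp only [e2]
    rw [← diag_union_offDiag, sum_union (disjoint_diag_offDiag A), sum_diag]
    simp only [and_self, h1]
    rw [sum_const, nsmul_eq_mul, sum_congr rfl fun q hq => h2 q.1 q.2 (mem_offDiag.1 hq).2.2,
      sum_const, offDiag_card, nsmul_eq_mul, Nat.cast_sub (Nat.le_mul_self _), Nat.cast_mul]
  have hμ : (#A : ℝ) * τ / N = #A * p := by rw [hp, mul_div_assoc]
  simp only [hμ]
  have e3 : ∀ h : α → ℕ, ((#(A.filter fun x => h x ≤ τ) : ℝ) - #A * p) ^ 2 =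
      (#(A.filter fun x => h x ≤ τ) : ℝ) ^ 2 - 2 * (#A * p) * #(A.filter fun x => h x ≤ τ) +
        (#A * p) ^ 2 := fun h => by ring
  simp only [e3]
  rw [sum_add_distrib, sum_sub_distrib, ← mul_sum, s1, s2, sum_const, nsmul_eq_mul, ← hK]
  -- The covariances cancel, so the average square is exactly #A · p(1 - p); the term in p² is
  -- dropped.
  have : (0 : ℝ) ≤ #A * K * p ^ 2 := by positivity
  linarith

theorem TwoUniversalFamily.chebyshev (hα : Nontrivial α) (hN : 0 < N) (A : Finset α) {τ : ℕ}
    (hτ : τ ≤ N) {r : ℝ} (hr : 0 ≤ r) (P : (α → ℕ) → Prop) [DecidablePred P]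
    (hP : ∀ h ∈ F.carrier, P h → r ≤ |(#(A.filter fun x => h x ≤ τ) : ℝ) - #A * τ / N|) :
    #(F.carrier.filter P) * r ^ 2 ≤ #F.carrier * (#A * τ / N) := by
  refine le_trans ?_ (F.sum_sq_le hα hN A hτ)
  have h1 : (#(F.carrier.filter P) : ℝ) * r ^ 2 = ∑ _h ∈ F.carrier.filter P, r ^ 2 := by
    rw [sum_const, nsmul_eq_mul]
  rw [h1]
  refine (sum_le_sum fun h hh => ?_).trans
    (sum_le_sum_of_subset_of_nonneg (filter_subset P _) fun _ _ _ => sq_nonneg _)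
  rw [← sq_abs ((#(A.filter fun x => h x ≤ τ) : ℝ) - #A * τ / N)]
  exact pow_le_pow_left₀ hr (hP h (mem_filter.1 hh).1 (mem_filter.1 hh).2) 2

/-- Mean and variance are at most 3t/4, and reaching `t` is a deviation of at least t/4, so
Chebyshev gives (3t/4)/(t/4)² = 12/t. -/
theorem TwoUniversalFamily.card_low (hα : Nontrivial α) (hN : 0 < N) (A : Finset α) {t : ℕ}
    (ht : 0 < t) (hs : t ≤ #A) :
    (t : ℝ) * #(F.carrier.filter fun h =>
      t ≤ #(A.filter fun x => h x ≤ ⌊3 * t * N / (4 * #A : ℝ)⌋₊)) ≤ 12 * #F.carrier := by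
  have htR : (0 : ℝ) < t := by exact_mod_cast ht
  have hsR : (t : ℝ) ≤ #A := by exact_mod_cast hs
  have hNR0 : (0 : ℝ) < N := by exact_mod_cast hN
  have hA0 : (0 : ℝ) < #A := by linarith
  obtain ⟨τ, hτ⟩ : ∃ τ, τ = ⌊3 * t * N / (4 * #A : ℝ)⌋₊ := ⟨_, rfl⟩
  rw [← hτ]
  have hτ' : (τ : ℝ) ≤ 3 * t * N / (4 * #A : ℝ) := hτ ▸ Nat.floor_le (by positivity)
  have hτN : τ ≤ N := by
    have : (τ : ℝ) ≤ N := by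
      refine hτ'.trans ?_
      rw [div_le_iff₀ (by positivity)]
      nlinarith
    exact_mod_cast this
  have hμ : (#A : ℝ) * τ / N ≤ 3 * t / 4 := by
    rw [le_div_iff₀ (by positivity)] at hτ'
    rw [div_le_iff₀ hNR0]
    linarith
  have := F.chebyshev hα hN A hτN (r := t / 4) (by positivity)
    (fun h => t ≤ #(A.filter fun x => h x ≤ τ)) fun h _ h1 => by
      have h1' : (t : ℝ) ≤ #(A.filter fun x => h x ≤ τ) := by exact_mod_cast h1
      exact le_trans (by linarith) (le_abs_self _)
  have h2 := this.trans (mul_le_mul_of_nonneg_left hμ (Nat.cast_nonneg _))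
  refine le_of_mul_le_mul_left ?_ htR
  linarith

/-- The mean lies between 3t/2 - 1 and 3t/2; rounding the threshold down costs at most #A/N ≤ 1.
Staying below `t` is then a deviation of at least t/2 - 1 ≥ t/4, and Chebyshev gives (3t/2)/(t/4)² =
24/t. -/
theorem TwoUniversalFamily.card_high (hα : Nontrivial α) (hN : 0 < N) (A : Finset α) {t : ℕ}
    (ht : 4 ≤ t) (hs : t ≤ #A) (hAN : #A ≤ N) :
    (t : ℝ) * #(F.carrier.filter fun h => 3 * t * N / (2 * #A : ℝ) < N ∧
      #(A.filter fun x => h x ≤ ⌊3 * t * N / (2 * #A : ℝ)⌋₊) < t) ≤ 24 * #F.carrier := by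
  have htR : (4 : ℝ) ≤ t := by exact_mod_cast ht
  have hsR : (t : ℝ) ≤ #A := by exact_mod_cast hs
  have hNR0 : (0 : ℝ) < N := by exact_mod_cast hN
  have hANR : (#A : ℝ) ≤ N := by exact_mod_cast hAN
  have hA0 : (0 : ℝ) < #A := by linarith
  by_cases hlt : 3 * t * N / (2 * #A : ℝ) < N
  · obtain ⟨τ, hτ⟩ : ∃ τ, τ = ⌊3 * t * N / (2 * #A : ℝ)⌋₊ := ⟨_, rfl⟩
    rw [← hτ]
    have hτ' : (τ : ℝ) ≤ 3 * t * N / (2 * #A : ℝ) := hτ ▸ Nat.floor_le (by positivity)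
    have hτ'' : 3 * t * N / (2 * #A : ℝ) < τ + 1 := hτ ▸ Nat.lt_floor_add_one _
    have hτN : τ ≤ N := by exact_mod_cast hτ'.trans hlt.le
    have hμ : (#A : ℝ) * τ / N ≤ 3 * t / 2 := by
      rw [le_div_iff₀ (by positivity)] at hτ'
      rw [div_le_iff₀ hNR0]
      linarith
    have hμ' : 3 * t / 2 - 1 ≤ (#A : ℝ) * τ / N := by
      rw [div_lt_iff₀ (by positivity)] at hτ''
      rw [le_div_iff₀ hNR0]
      linarith
    have := F.chebyshev hα hN A hτN (r := t / 4) (by positivity)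
      (fun h => 3 * t * N / (2 * #A : ℝ) < N ∧ #(A.filter fun x => h x ≤ τ) < t)
      fun h _ h1 => by
        have h1' : (#(A.filter fun x => h x ≤ τ) : ℝ) < t := by exact_mod_cast h1.2
        exact le_trans (by linarith) (neg_le_abs _)
    have h2 := this.trans (mul_le_mul_of_nonneg_left hμ (Nat.cast_nonneg _))
    refine le_of_mul_le_mul_left ?_ (show (0 : ℝ) < t by linarith)
    linarith
  · rw [filter_false_of_mem fun h _ h1 => hlt h1.1]
    simp

end Hashing

open Classical in
/-- A single tree is inaccurate for at most one eighth of the hash functions. -/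
theorem TwoUniversalFamily.card_inaccurate {α : Type*} [Fintype α] [DecidableEq α]
    (F : TwoUniversalFamily α (Fintype.card α ^ 3)) (hα : Nontrivial α) {t : ℕ} (ht : 300 ≤ t)
    (A : Finset α) :
    8 * #(F.carrier.filter fun h => ¬ Accurate
      (treeEstimate t (Fintype.card α ^ 3) (smallest t (A.image h))) #A) ≤ #F.carrier := by
  obtain ⟨m, hm⟩ : ∃ m, m = Fintype.card α := ⟨_, rfl⟩
  obtain ⟨N, hN⟩ : ∃ N, N = Fintype.card α ^ 3 := ⟨_, rfl⟩
  revert F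
  rw [← hN]
  intro F
  have hm2 : 2 ≤ m := hm ▸ Fintype.one_lt_card
  have hNm : N = m ^ 3 := by rw [hN, hm]
  have hNpos : 0 < N := by rw [hNm]; positivity
  have hAm : #A ≤ m := hm ▸ card_le_univ A
  have hcoll := F.card_not_injOn hNpos A (fun h => ¬ Set.InjOn h A) fun _ h => h
  set c₁ := #(F.carrier.filter fun h => ¬ Set.InjOn h A)
  have hNR : (N : ℝ) = (m : ℝ) ^ 3 := by exact_mod_cast hNm
  have hm2R : (2 : ℝ) ≤ m := by exact_mod_cast hm2
  have hAmR : (#A : ℝ) ≤ m := by exact_mod_cast hAm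
  have hcollR : 2 * (N : ℝ) * c₁ ≤ (#A * #A - #A) * #F.carrier := by
    have := (Nat.cast_le (α := ℝ)).2 hcoll
    rw [Nat.cast_mul, Nat.cast_mul, Nat.cast_mul, Nat.cast_sub (Nat.le_mul_self _)] at this
    push_cast at this
    exact this
  have hK : (0 : ℝ) ≤ #F.carrier := by positivity
  have hc₁ : (0 : ℝ) ≤ c₁ := by positivity
  have hmain : ∀ h ∈ F.carrier, ¬ Accurate (treeEstimate t N (smallest t (A.image h))) #A →
      Set.InjOn h A → (t ≤ #A ∧ t ≤ #(A.filter fun x => h x ≤ ⌊3 * t * N / (4 * #A : ℝ)⌋₊)) ∨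
        (t ≤ #A ∧ 3 * t * N / (2 * #A : ℝ) < N ∧
          #(A.filter fun x => h x ≤ ⌊3 * t * N / (2 * #A : ℝ)⌋₊) < t) := by
    intro h hh hbad hinj
    by_contra hcon
    push Not at hcon
    exact hbad (accurate_treeEstimate hNpos (by omega) (F.mem_range h hh) hinj
      (fun h1 => hcon.1 h1) fun h1 h2 => hcon.2 h1 h2)
  have key : (8 : ℝ) * #(F.carrier.filter fun h => ¬ Accurate
      (treeEstimate t N (smallest t (A.image h))) #A) ≤ #F.carrier := by
    by_cases hs : #A < t
    · have hle : #(F.carrier.filter fun h => ¬ Accurate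
          (treeEstimate t N (smallest t (A.image h))) #A) ≤ c₁ := by
        refine card_le_card fun h hh => ?_
        obtain ⟨hF, hbad⟩ := mem_filter.1 hh
        refine mem_filter.2 ⟨hF, fun hinj => ?_⟩
        rcases hmain h hF hbad hinj with h1 | h1 <;> omega
      have hleR : (#(F.carrier.filter fun h => ¬ Accurate
          (treeEstimate t N (smallest t (A.image h))) #A) : ℝ) ≤ c₁ := by exact_mod_cast hle
      have h0 : (#A : ℝ) * #A - #A ≤ m * m - m := by
        have h0' : (0 : ℝ) ≤ #A := by positivity
        rcases Nat.eq_zero_or_pos #A with h0 | h0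
        · rw [h0]
          norm_num
          nlinarith
        · have : (1 : ℝ) ≤ #A := by exact_mod_cast h0
          nlinarith
      have h1 : 2 * (m : ℝ) ^ 3 * c₁ ≤ (m * m - m) * #F.carrier := by
        rw [← hNR]
        exact hcollR.trans (by gcongr)
      -- The difference is m(m - 2)². When #A < t only collisions can spoil the sketch, and this
      -- bounds their probability by 1/8.
      have h2 : 4 * ((m : ℝ) * m - m) ≤ m ^ 3 := by nlinarith [sq_nonneg ((m : ℝ) - 2)]
      have h3 : (m : ℝ) ^ 3 * (8 * c₁) ≤ m ^ 3 * #F.carrier := by nlinarith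
      have := le_of_mul_le_mul_left h3 (by positivity)
      linarith
    · push Not at hs
      have htR : (300 : ℝ) ≤ t := by exact_mod_cast ht
      have hsR : (t : ℝ) ≤ #A := by exact_mod_cast hs
      have hNR0 : (0 : ℝ) < N := by exact_mod_cast hNpos
      have hA0 : (0 : ℝ) < #A := by linarith
      set c₂ := #(F.carrier.filter fun h =>
        t ≤ #(A.filter fun x => h x ≤ ⌊3 * t * N / (4 * #A : ℝ)⌋₊)) with hc₂
      set c₃ := #(F.carrier.filter fun h => 3 * t * N / (2 * #A : ℝ) < N ∧
          #(A.filter fun x => h x ≤ ⌊3 * t * N / (2 * #A : ℝ)⌋₊) < t) with hc₃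
      have hle : #(F.carrier.filter fun h => ¬ Accurate
          (treeEstimate t N (smallest t (A.image h))) #A) ≤ c₁ + c₂ + c₃ := by
        refine (card_le_card (t := _ ∪ _ ∪ _) fun h hh => ?_).trans
          ((card_union_le _ _).trans (Nat.add_le_add_right (card_union_le _ _) _))
        obtain ⟨hF, hbad⟩ := mem_filter.1 hh
        by_cases hinj : Set.InjOn h A
        · rcases hmain h hF hbad hinj with h1 | h1
          · exact mem_union_left _ (mem_union_right _ (mem_filter.2 ⟨hF, h1.2⟩))
          · exact mem_union_right _ (mem_filter.2 ⟨hF, h1.2⟩)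
        · exact mem_union_left _ (mem_union_left _ (mem_filter.2 ⟨hF, hinj⟩))
      have hleR : (#(F.carrier.filter fun h => ¬ Accurate
          (treeEstimate t N (smallest t (A.image h))) #A) : ℝ) ≤ c₁ + c₂ + c₃ := by
        exact_mod_cast hle
      have hsm : (#A : ℝ) ≤ N := by
        rw [hNR]
        exact hAmR.trans (le_self_pow₀ (by linarith) (by norm_num))
      have b₁ : t * (c₁ : ℝ) ≤ #F.carrier := by
        have h1 : 2 * (m : ℝ) ^ 3 * c₁ ≤ m ^ 2 * #F.carrier := by
          rw [← hNR]
          refine hcollR.trans ?_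
          gcongr
          nlinarith
        have h2 : (m : ℝ) ^ 2 * (2 * m * c₁) ≤ m ^ 2 * #F.carrier := by linarith
        have := le_of_mul_le_mul_left h2 (by positivity)
        have htm : (t : ℝ) * c₁ ≤ m * c₁ := by gcongr; linarith
        nlinarith
      have b₂ : t * (c₂ : ℝ) ≤ 12 * #F.carrier := F.card_low hα hNpos A (by omega) hs
      have b₃ : t * (c₃ : ℝ) ≤ 24 * #F.carrier := F.card_high hα hNpos A (by omega) hs (by
        exact_mod_cast hsm)
      have h4 : (0 : ℝ) ≤ #(F.carrier.filter fun h => ¬ Accurate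
          (treeEstimate t N (smallest t (A.image h))) #A) := by positivity
      set c₀ := (#(F.carrier.filter fun h => ¬ Accurate
          (treeEstimate t N (smallest t (A.image h))) #A) : ℝ)
      -- Collisions, low counts and high counts contribute 1 + 12 + 24 = 37, and 8 · 37 = 296 ≤ 300
      -- ≤ t.
      have h5 : t * c₀ ≤ 37 * #F.carrier := by nlinarith
      nlinarith
  exact_mod_cast key

/-! ### Amplification by the median. -/

section Median

theorem countP_ofFn {k : ℕ} (x : Fin k → ℝ) (P : ℝ → Prop) [DecidablePred P] :
    (List.ofFn x).countP (fun y => decide (P y)) = #(univ.filter fun i => P (x i)) := by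
  rw [← Multiset.coe_countP, ← Fin.univ_val_map, Multiset.countP_map]
  rfl

open Classical in
-- A median that is too small makes the first k/2 + 1 sorted entries too small, and one that is too
-- large makes the last k - k/2 too large; either way at least half are bad.
theorem le_card_of_not_accurate_median {k : ℕ} (hk : 0 < k) (x : Fin k → ℝ) (s : ℕ)
    (h : ¬ Accurate (median x) s) : k ≤ 2 * #(univ.filter fun i => ¬ Accurate (x i) s) := by
  set l := (List.ofFn x).mergeSort fun a b => decide (a ≤ b) with hl
  have hlen : l.length = k := by simp [hl]
  have hsort : l.Pairwise (· ≤ ·) := by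
    refine (List.pairwise_mergeSort (le := fun a b : ℝ => decide (a ≤ b))
      ?_ ?_ (List.ofFn x)).imp fun h => of_decide_eq_true h
    · intro a b c hab hbc
      simp only [decide_eq_true_eq] at *
      exact hab.trans hbc
    · intro a b
      simp only [Bool.or_eq_true, decide_eq_true_eq]
      exact le_total a b
  have hmed : median x = l[k / 2]'(by omega) := by
    rw [median, ← hl, List.getD_eq_getElem _ _ (by omega)]
  have hcount : ∀ (P : ℝ → Prop) [DecidablePred P], #(univ.filter fun i => P (x i)) =
      l.countP fun y => decide (P y) := by
    intro P _
    rw [← countP_ofFn, (List.mergeSort_perm _ _).countP_eq]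
  rw [hcount fun y => ¬ Accurate y s]
  have hall : ∀ l' : List ℝ, (∀ y ∈ l', ¬ Accurate y s) → l'.Sublist l →
      l'.length ≤ l.countP fun y => decide (¬ Accurate y s) := by
    intro l' h' hsub
    have hlen' : l'.countP (fun y => decide (¬ Accurate y s)) = l'.length :=
      List.countP_eq_length.2 fun y hy => by simpa using h' y hy
    exact hlen' ▸ hsub.countP_le
  rw [hmed, Accurate, not_and_or, not_le, not_le] at h
  have hmono : ∀ i j (hi : i < l.length) (hj : j < l.length), i ≤ j → l[i] ≤ l[j] := by
    intro i j hi hj hij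
    rcases hij.eq_or_lt with rfl | hij
    · exact le_rfl
    · exact List.pairwise_iff_getElem.1 hsort i j hi hj hij
  rcases h with h | h
  · have := hall (l.take (k / 2 + 1)) (fun y hy => by
      obtain ⟨i, hi, rfl⟩ := List.getElem_of_mem hy
      rw [List.length_take] at hi
      rw [List.getElem_take]
      exact fun hacc => absurd hacc.1 (not_le.2 ((hmono i (k / 2) (by omega) (by omega)
        (by omega)).trans_lt h))) (List.take_sublist _ _)
    rw [List.length_take] at this
    omega
  · have := hall (l.drop (k / 2)) (fun y hy => by
      obtain ⟨i, hi, rfl⟩ := List.getElem_of_mem hy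
      rw [List.length_drop] at hi
      rw [List.getElem_drop]
      exact fun hacc => absurd hacc.2 (not_le.2 (h.trans_le
        (hmono (k / 2) (k / 2 + i) (by omega) (by omega) (by omega))))) (List.drop_sublist _ _)
    rw [List.length_drop] at this
    omega

/-- If at most an eighth of `K` is bad, few `k`-tuples are bad in at least half of the entries. -/
theorem card_majority_bad {β : Type*} (K : Finset β) (bad : β → Prop) [DecidablePred bad]
    (hbad : 8 * #(K.filter bad) ≤ #K) (k : ℕ) :
    (#((Fintype.piFinset fun _ : Fin k => K).filter fun h =>
      k ≤ 2 * #(univ.filter fun i => bad (h i))) : ℝ) ≤ (2 / 3) ^ k * (#K : ℝ) ^ k := by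
  -- Exponential moment with base 9: the average weight is at most 1 + 8 · (1/8) = 2, while a tuple
  -- that is bad in half its entries has weight at least 9^(k/2) = 3^k.
  set w : β → ℝ := fun b => if bad b then 9 else 1 with hw
  classical
  have hsum : ∑ b ∈ K, w b ≤ 2 * #K := by
    have : ∑ b ∈ K, w b = 9 * #(K.filter bad) + (#K - #(K.filter bad)) := by
      rw [hw, sum_ite, sum_const, sum_const, nsmul_eq_mul, nsmul_eq_mul, filter_not,
        card_sdiff_of_subset (filter_subset _ _), Nat.cast_sub (card_filter_le _ _)]
      ring
    rw [this]
    have : (8 : ℝ) * #(K.filter bad) ≤ #K := by exact_mod_cast hbad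
    linarith
  have hw0 : ∀ b, 0 ≤ w b := fun b => by
    simp only [hw]
    split_ifs <;> norm_num
  have hprod : ∀ h : Fin k → β, ∏ i, w (h i) = 9 ^ #(univ.filter fun i => bad (h i)) := by
    intro h
    simp only [hw]
    rw [prod_ite, prod_const, prod_const_one, mul_one]
  have h1 : ∑ h ∈ Fintype.piFinset fun _ : Fin k => K, ∏ i, w (h i) ≤ (2 * #K) ^ k := by
    rw [← prod_univ_sum (fun _ : Fin k => K) fun _ b => w b, prod_const, card_univ,
      Fintype.card_fin]
    exact pow_le_pow_left₀ (sum_nonneg fun b _ => hw0 b) hsum k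
  have h2 : (#((Fintype.piFinset fun _ : Fin k => K).filter fun h =>
      k ≤ 2 * #(univ.filter fun i => bad (h i))) : ℝ) * 3 ^ k ≤ (2 * #K) ^ k := by
    refine le_trans ?_ h1
    rw [← nsmul_eq_mul]
    refine (card_nsmul_le_sum _ (fun h => ∏ i, w (h i)) _ fun h hh => ?_).trans
      (sum_le_sum_of_subset_of_nonneg (filter_subset _ _)
        fun h _ _ => prod_nonneg fun i _ => hw0 (h i))
    rw [hprod, show (9 : ℝ) = 3 ^ 2 by norm_num, ← pow_mul]
    exact pow_le_pow_right₀ (by norm_num) (mem_filter.1 hh).2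
  rw [div_pow, div_mul_eq_mul_div, le_div_iff₀ (by positivity), ← mul_pow]
  exact h2

end Median

/-! ### Simultaneous accuracy of all estimates of one invocation. -/

section Estimates

open Classical in
/-- With many hash functions, the medians of the tree estimates of all sets of a finite family
are accurate with high probability. -/
theorem drawHashes_accurate {α ι : Type*} [Fintype α] [DecidableEq α] [Fintype ι]
    (F : TwoUniversalFamily α (Fintype.card α ^ 3)) (hα : Nontrivial α) {t k : ℕ} (ht : 300 ≤ t)
    (hk : 0 < k) (A : ι → Finset α) :
    (drawHashes F k).toOuterMeasure {h | ¬ ∀ v, Accurate (median fun i =>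
      treeEstimate t (Fintype.card α ^ 3) (smallest t ((A v).image (h i)))) #(A v)} ≤
      Fintype.card ι * ENNReal.ofReal ((2 / 3) ^ k) := by
  have hsingle : ∀ v, (drawHashes F k).toOuterMeasure {h | ¬ Accurate (median fun i =>
      treeEstimate t (Fintype.card α ^ 3) (smallest t ((A v).image (h i)))) #(A v)} ≤
      ENNReal.ofReal ((2 / 3) ^ k) := by
    intro v
    rw [drawHashes, PMF.toOuterMeasure_uniformOfFinset_apply]
    have h0 : 0 < #(Fintype.piFinset fun _ : Fin k => F.carrier) :=
      card_pos.2 (Fintype.piFinset_nonempty.2 fun _ => F.nonempty)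
    refine ENNReal.div_le_of_le_mul ?_
    have h1 := card_majority_bad F.carrier (fun h => ¬ Accurate (treeEstimate t
      (Fintype.card α ^ 3) (smallest t ((A v).image h))) #(A v)) (F.card_inaccurate hα ht (A v)) k
    have h2 : (#((Fintype.piFinset fun _ : Fin k => F.carrier).filter fun h =>
        h ∈ {h | ¬ Accurate (median fun i => treeEstimate t (Fintype.card α ^ 3)
          (smallest t ((A v).image (h i)))) #(A v)}) : ℝ) ≤ (2 / 3) ^ k *
          #(Fintype.piFinset fun _ : Fin k => F.carrier) := by
      rw [Fintype.card_piFinset_const, Nat.cast_pow]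
      refine le_trans ?_ h1
      exact Nat.cast_le.2 (card_le_card fun h hh => mem_filter.2 ⟨(mem_filter.1 hh).1,
        le_card_of_not_accurate_median hk _ _ (mem_filter.1 hh).2⟩)
    have h3 := ENNReal.ofReal_le_ofReal h2
    rw [ENNReal.ofReal_natCast, ENNReal.ofReal_mul (by positivity), ENNReal.ofReal_natCast] at h3
    convert h3
  have hunion : {h : Fin k → α → ℕ | ¬ ∀ v, Accurate (median fun i =>
      treeEstimate t (Fintype.card α ^ 3) (smallest t ((A v).image (h i)))) #(A v)} =
      ⋃ v, {h | ¬ Accurate (median fun i =>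
        treeEstimate t (Fintype.card α ^ 3) (smallest t ((A v).image (h i)))) #(A v)} := by
    ext h
    simp
  rw [hunion]
  refine (MeasureTheory.measure_iUnion_le _).trans ?_
  rw [tsum_fintype]
  refine (sum_le_card_nsmul _ _ _ fun v _ => hsingle v).trans ?_
  rw [nsmul_eq_mul, card_univ]

variable {V : Type*} [Fintype V] [DecidableEq V]

/-- A bound for the probability that some estimate of one invocation is inaccurate. -/
noncomputable def estimateError (cfg : Config V) : ℝ≥0∞ :=
  Fintype.card V * ENNReal.ofReal ((2 / 3) ^ logCount cfg.c' (Fintype.card V))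

theorem logCount_pos (c : ℝ) (n : ℕ) : 0 < logCount c n := lt_max_of_lt_left one_pos

variable {cfg : Config V} {G : Digraph V}

theorem estimateV_accurate (hV : Nontrivial V) (ht : 300 ≤ treeSize cfg.c) (hG : Acyclic G)
    (S : Finset V) :
    HoldsExcept (OptionT.lift (estimateV cfg G S)) (estimateError cfg)
      fun nV => ∀ v, Accurate (nV v) #(anc G S v) := by
  refine HoldsExcept.lift ?_
  rw [estimateV, PMF.toOuterMeasure_map_apply]
  refine le_trans (le_of_eq ?_)
    (drawHashes_accurate cfg.hashV hV ht (logCount_pos _ _) fun v => anc G S v)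
  congr 1
  ext h
  simp only [Set.mem_preimage, Set.mem_ofPred_eq, vertexTrees_eq hG]

theorem estimateE_accurate (hV : Nontrivial V) (ht : 300 ≤ treeSize cfg.c) (hG : Acyclic G)
    (S : Finset V) :
    HoldsExcept (OptionT.lift (estimateE cfg G S)) (estimateError cfg)
      fun nE => ∀ v, Accurate (nE v) #(edgesIn G (anc G S v)) := by
  refine HoldsExcept.lift ?_
  rw [estimateE, PMF.toOuterMeasure_map_apply]
  refine le_trans (le_of_eq ?_) (drawHashes_accurate cfg.hashE inferInstance ht
    (logCount_pos _ _) fun v => edgesIn G (anc G S v))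
  congr 1
  ext h
  simp only [Set.mem_preimage, Set.mem_ofPred_eq, edgeTrees_eq hG]

end Estimates

/-! ### Lower bounds on the optimum and the partition into layers. -/

section Partition

variable {V : Type*} {G : Digraph V}

theorem le_makespan {M : ℕ} {σ : Schedule V M} {m : Fin M} {v : V} {t : ℕ}
    (hm : (m, v, t) ∈ σ) : t ≤ makespan σ :=
  le_sup (f := fun p : Fin M × V × ℕ => p.2.2) hm

theorem IsFeasible.card_le [Fintype V] {M ρ : ℕ} {σ : Schedule V M} (hσ : IsFeasible G ρ σ) :
    Fintype.card V ≤ M * makespan σ := by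
  choose μ τ h using hσ.all_jobs
  have hcard := card_le_card_of_injOn (s := (univ : Finset V))
    (t := (univ : Finset (Fin M)) ×ˢ Icc 1 (makespan σ)) (fun v => (μ v, τ v))
    (fun v _ => by
      simpa using ⟨hσ.time_pos _ _ _ (h v), le_makespan (h v)⟩)
    (fun u _ v _ huv => by
      simp only [Prod.mk.injEq] at huv
      exact hσ.one_at_a_time (μ u) (τ u) u v (h u) (by rw [huv.1, huv.2]; exact h v))
  rwa [card_product, card_univ, card_univ, Fintype.card_fin, Nat.card_Icc,
    Nat.add_sub_cancel] at hcard

variable [DecidableEq V]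

/-- Jobs with more than `ρ` ancestors among jobs that start after time `k ρ` finish after time
`(k + 1) ρ`. -/
theorem IsFeasible.lt_of_lt_card_anc {M ρ : ℕ} {σ : Schedule V M} (hσ : IsFeasible G ρ σ)
    {R : Finset V} {k : ℕ} (hR : ∀ v ∈ R, ∀ m t, (m, v, t) ∈ σ → k * ρ < t) {v : V}
    (hv : ρ < #(anc G R v)) {m : Fin M} {t : ℕ} (hm : (m, v, t) ∈ σ) : (k + 1) * ρ < t := by
  by_contra hle
  push Not at hle
  have hle' : t ≤ k * ρ + ρ := by linarith
  -- If `v` ran by time (k + 1)ρ, a transfer from another machine would require a job of `R` in a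
  -- slot before kρ. So all its ancestors in `R` run on `m`, and they do not fit into the ρ slots
  -- available.
  have key : ∀ u ∈ anc G R v, ∃ t', t' ≤ t ∧ (m, u, t') ∈ σ := by
    intro u hu
    have hr := (mem_anc.1 hu).2.2
    induction hr using Relation.ReflTransGen.head_induction_on with
    | refl => exact ⟨t, le_rfl, hm⟩
    | head hab hbv ih =>
      obtain ⟨t₁, ht₁, hm₁⟩ := ih (mem_anc.2 ⟨hab.2.1, (mem_anc.1 hu).2.1, hbv⟩)
      rcases hσ.precedence m _ t₁ hm₁ _ hab.2.2 with ⟨t₂, h, hlt⟩ | ⟨m₂, t₂, -, h, hlt⟩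
      · exact ⟨t₂, by omega, h⟩
      · have := hR _ hab.1 m₂ t₂ h
        omega
  choose! τ hτ hτσ using key
  have hcard := card_le_card_of_injOn (s := anc G R v) (t := Ioc (k * ρ) t) τ
    (fun u hu => mem_coe.2 (mem_Ioc.2 ⟨hR u (anc_subset hu) m _ (hτσ u hu), hτ u hu⟩))
    (fun u hu w hw huw => hσ.one_at_a_time m (τ u) u w (hτσ u hu) (huw ▸ hτσ w hw))
  rw [Nat.card_Ioc] at hcard
  omega

/-- Successive small subgraphs: all predecessors of a layer are in the layer or in an earlier one
(the set `D` counts as the layer before the first), and no job has more than `2 ρ` ancestors in its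
layer. -/
def Layered (G : Digraph V) (ρ : ℕ) : Finset V → List (Finset V) → Prop
  | _, [] => True
  | D, H :: Hs => (∀ v ∈ H, ∀ u, G.Adj u v → u ∈ H ∨ u ∈ D) ∧ (∀ v ∈ H, #(anc G H v) ≤ 2 * ρ) ∧
      Layered G ρ (D ∪ H) Hs

theorem Layered.append_singleton {ρ : ℕ} {H : Finset V} :
    ∀ {Hs : List (Finset V)} {D : Finset V}, Layered G ρ D Hs →
      Layered G ρ (Hs.foldl (· ∪ ·) D) [H] → Layered G ρ D (Hs ++ [H])
  | [], _, _, h => h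
  | _ :: _, _, h, h' => ⟨h.1, h.2.1, h.2.2.append_singleton h'⟩

/-- Every eligible unmarked job is waiting in the queue unless its estimate is too large. Rejection
is final because the estimates are fixed during the construction. -/
theorem buildSmall_spec (hG : Acyclic G) (ρ : ℕ) (nV : V → ℝ) {fuel : ℕ} (R : Finset V)
    (hfuel : (#R + 1) * #R + #R ≤ fuel) :
    HoldsExcept (buildSmall G ρ nV fuel R) 0 fun q => q.2 ⊆ R ∧
      (∀ v ∈ q.2, nV v ≤ 4 / 3 * (ρ : ℝ) ∧ pred G R v ⊆ q.2) ∧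
      ∀ w ∈ R, pred G R w ⊆ q.2 → nV w ≤ 4 / 3 * (ρ : ℝ) → w ∈ q.2 := by
  let Inv : List V × Finset V → Prop := fun st =>
    st.1.Nodup ∧ (∀ w ∈ st.1, w ∈ R ∧ pred G R w ⊆ st.2 ∧ w ∉ st.2) ∧ st.2 ⊆ R ∧
      (∀ v ∈ st.2, nV v ≤ 4 / 3 * (ρ : ℝ) ∧ pred G R v ⊆ st.2) ∧
      ∀ w ∈ R, pred G R w ⊆ st.2 → nV w ≤ 4 / 3 * (ρ : ℝ) → w ∈ st.2 ∨ w ∈ st.1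
  have hlen : ∀ st, Inv st → st.1.length ≤ #R := fun st h => by
    rw [← List.toFinset_card_of_nodup h.1]
    exact card_le_card fun w hw => (h.2.1 w (List.mem_toFinset.1 hw)).1
  -- Marking a job may lengthen the queue, but never beyond `#R`, so one unmarked job must weigh `#R
  -- + 1`; a rejection just shortens the queue.
  let m : List V × Finset V → ℕ := fun st => (#R + 1) * #(R \ st.2) + st.1.length
  have h0 : Inv ((R.filter fun v => pred G R v = ∅).toList, ∅) := by
    refine ⟨nodup_toList _, fun w hw => ?_, empty_subset _, by simp, fun w hw hp _ => .inr ?_⟩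
    · obtain ⟨hwR, hp⟩ := mem_filter.1 (mem_toList.1 hw)
      exact ⟨hwR, hp.subset, notMem_empty _⟩
    · exact mem_toList.2 (mem_filter.2 ⟨hw, subset_empty.1 hp⟩)
  refine (HoldsExcept.whileLoop (δ := 0) Inv m ?_ ?_ fuel _ h0 ?_).mono (by simp) ?_
  · rintro ⟨Q, X⟩ - hQ
    exact Nat.add_pos_right _ (List.length_pos_iff.2 hQ)
  · rintro ⟨Q, X⟩ hInv hQ
    cases Q with
    | nil => exact absurd rfl hQ
    | cons v Q =>
      obtain ⟨hnd, hQ', hXR, hX, hall⟩ := id hInv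
      obtain ⟨hvR, hvp, hvX⟩ := hQ' v (by simp)
      rw [List.nodup_cons] at hnd
      refine HoldsExcept.ite (fun hpass => HoldsExcept.pure ?_) fun hfail => HoldsExcept.pure ?_
      · have hnew : Inv (Q ++ ((succ G R v).filter fun w => pred G R w ⊆ insert v X).toList,
            insert v X) := by
          refine ⟨?_, ?_, ?_, ?_, ?_⟩
          · refine hnd.2.append (nodup_toList _) fun w hw hw' => hvX ?_
            have hw' := mem_succ.1 (mem_filter.1 (mem_toList.1 hw')).1
            exact (hQ' w (by simp [hw])).2.1 (mem_pred.2 ⟨hvR, hw'.2⟩)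
          · intro w hw
            rcases List.mem_append.1 hw with hw | hw
            · obtain ⟨h1, h2, h3⟩ := hQ' w (by simp [hw])
              refine ⟨h1, h2.trans (subset_insert _ _), fun h => ?_⟩
              rcases mem_insert.1 h with rfl | h
              · exact hnd.1 ‹_›
              · exact h3 h
            · obtain ⟨hs, hp⟩ := mem_filter.1 (mem_toList.1 hw)
              obtain ⟨hwR, hvw⟩ := mem_succ.1 hs
              refine ⟨hwR, hp, fun h => ?_⟩
              rcases mem_insert.1 h with rfl | h
              · exact hG.not_adj_self hvw
              · exact hvX ((hX w h).2 (mem_pred.2 ⟨hvR, hvw⟩))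
          · exact insert_subset hvR hXR
          · intro w hw
            rcases mem_insert.1 hw with rfl | hw
            · exact ⟨hpass, hvp.trans (subset_insert _ _)⟩
            · exact ⟨(hX w hw).1, (hX w hw).2.trans (subset_insert _ _)⟩
          · intro w hw hp hle
            by_cases hvw : G.Adj v w
            · exact .inr (List.mem_append_right _ (mem_toList.2
                (mem_filter.2 ⟨mem_succ.2 ⟨hw, hvw⟩, hp⟩)))
            · have hp' : pred G R w ⊆ X := fun u hu => by
                rcases mem_insert.1 (hp hu) with rfl | h
                · exact absurd (mem_pred.1 hu).2 hvw
                · exact h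
              rcases hall w hw hp' hle with h | h
              · exact .inl (mem_insert_of_mem h)
              · rcases List.mem_cons.1 h with rfl | h
                · exact .inl (mem_insert_self _ _)
                · exact .inr (List.mem_append_left _ h)
        refine ⟨hnew, ?_⟩
        have h1 := hlen _ hnew
        have h2 : #(R \ insert v X) + 1 = #(R \ X) := by
          rw [sdiff_insert, card_erase_add_one (mem_sdiff.2 ⟨hvR, hvX⟩)]
        simp only [m, ← h2, List.length_cons]
        simp only at h1
        nlinarith
      · refine ⟨⟨hnd.2, fun w hw => hQ' w (by simp [hw]), hXR, hX, fun w hw hp hle => ?_⟩, ?_⟩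
        · rcases hall w hw hp hle with h | h
          · exact .inl h
          · rcases List.mem_cons.1 h with rfl | h
            · exact absurd hle hfail
            · exact .inr h
        · simp [m]
  · have := hlen _ h0
    simp only [m, sdiff_empty] at this ⊢
    omega
  · rintro ⟨Q, X⟩ ⟨⟨-, -, hXR, hX, hall⟩, hQ⟩
    obtain rfl : Q = [] := by simpa using hQ
    exact ⟨hXR, hX, fun w hw hp hle => (hall w hw hp hle).resolve_right (by simp)⟩

variable [Fintype V]

/-- Each invocation of an estimation procedure is accurate except with probability `δ`. -/
structure EstimatesAccurate (cfg : Config V) (G : Digraph V) (δ : ℝ≥0∞) : Prop where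
  vertices : ∀ S, HoldsExcept (OptionT.lift (estimateV cfg G S)) δ
    fun nV => ∀ v, Accurate (nV v) #(anc G S v)
  edges : ∀ S, HoldsExcept (OptionT.lift (estimateE cfg G S)) δ
    fun nE => ∀ v, Accurate (nE v) #(edgesIn G (anc G S v))

/-- What is known about a complete or partial partition into layers with remaining jobs `R`. -/
structure IsPartition (G : Digraph V) (ρ : ℕ) (R : Finset V) (Hs : List (Finset V)) : Prop where
  closed : ∀ u v, v ∉ R → G.Adj u v → u ∉ R
  layered : Layered G ρ ∅ Hs
  cover : Hs.foldl (· ∪ ·) ∅ = univ \ R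
  length_add : Hs.length + #R ≤ Fintype.card V
  sum_card : (Hs.map card).sum + #R = Fintype.card V
  late : ∀ (M : ℕ) (σ : Schedule V M), IsFeasible G ρ σ →
    ∀ v ∈ R, ∀ m t, (m, v, t) ∈ σ → Hs.length * ρ < t
  length_mul : ∀ (M : ℕ) (σ : Schedule V M), IsFeasible G ρ σ → Hs.length * ρ ≤ makespan σ + ρ

/-- By induction on the number of ancestors, every job with at most ρ of them is marked, since its
estimate is at most 4ρ/3. So the jobs left over have more than ρ ancestors and are pushed back by ρ
in any schedule. Conversely, an estimate of at most 4ρ/3 allows at most 2ρ ancestors. -/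
theorem IsPartition.step (hG : Acyclic G) {ρ : ℕ} (hρ : 0 < ρ) {R : Finset V}
    {Hs : List (Finset V)} (h : IsPartition G ρ R Hs) (hR : R.Nonempty) {nV : V → ℝ}
    (hnV : ∀ v, Accurate (nV v) #(anc G R v)) {X : Finset V} (hXR : X ⊆ R)
    (hX : ∀ v ∈ X, nV v ≤ 4 / 3 * (ρ : ℝ) ∧ pred G R v ⊆ X)
    (hall : ∀ w ∈ R, pred G R w ⊆ X → nV w ≤ 4 / 3 * (ρ : ℝ) → w ∈ X) :
    IsPartition G ρ (R \ X) (Hs ++ [X]) ∧ #(R \ X) < #R := by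
  have hsmall : ∀ k, ∀ w ∈ R, #(anc G R w) = k → k ≤ ρ → w ∈ X := by
    intro k
    induction k using Nat.strong_induction_on with
    | _ k ih =>
      intro w hw hk hkρ
      refine hall w hw (fun u hu => ?_) ?_
      · have hlt := hG.card_anc_lt_of_pred hw hu
        exact ih _ (hk ▸ hlt) u (mem_pred.1 hu).1 rfl (by omega)
      · have h1 := (hnV w).2
        have h2 : (#(anc G R w) : ℝ) ≤ ρ := by exact_mod_cast hk ▸ hkρ
        linarith
  have hbig : ∀ w ∈ R \ X, ρ < #(anc G R w) := fun w hw => by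
    by_contra hle
    exact (mem_sdiff.1 hw).2 (hsmall _ w (mem_sdiff.1 hw).1 rfl (by omega))
  have hXne : X.Nonempty := by
    obtain ⟨w, hw, hmin⟩ := exists_min_image R (fun v => #(anc G R v)) hR
    have hp : pred G R w = ∅ := eq_empty_of_forall_notMem fun u hu =>
      absurd (hG.card_anc_lt_of_pred hw hu) (by have := hmin u (mem_pred.1 hu).1; omega)
    refine ⟨w, hsmall 1 w hw ?_ hρ⟩
    rw [anc_eq_insert hw, hp]
    simp
  have hcard : #(R \ X) + #X = #R := card_sdiff_add_card_eq_card hXR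
  have hXpos : 0 < #X := card_pos.2 hXne
  have hfold : (Hs ++ [X]).foldl (· ∪ ·) ∅ = univ \ R ∪ X := by
    rw [List.foldl_append, h.cover]
    rfl
  refine ⟨⟨?_, ?_, ?_, ?_, ?_, ?_, ?_⟩, by omega⟩
  · intro u v hv huv hu
    rw [mem_sdiff] at hu
    by_cases hvR : v ∈ R
    · have hvX : v ∈ X := by
        by_contra hvX
        exact hv (mem_sdiff.2 ⟨hvR, hvX⟩)
      exact hu.2 ((hX v hvX).2 (mem_pred.2 ⟨hu.1, huv⟩))
    · exact h.closed u v hvR huv hu.1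
  · refine h.layered.append_singleton ?_
    rw [h.cover]
    refine ⟨fun v hv u huv => ?_, fun v hv => ?_, trivial⟩
    · by_cases hu : u ∈ R
      · exact .inl ((hX v hv).2 (mem_pred.2 ⟨hu, huv⟩))
      · exact .inr (by simp [hu])
    · have h1 : (#(anc G X v) : ℝ) ≤ #(anc G R v) := by exact_mod_cast card_le_card (anc_mono hXR)
      have h2 := (hnV v).1
      have h3 := (hX v hv).1
      have : (#(anc G X v) : ℝ) ≤ 2 * ρ := by linarith
      exact_mod_cast this
  · rw [hfold]
    ext u
    simp
    tauto
  · have := h.length_add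
    simp only [List.length_append, List.length_singleton]
    omega
  · have := h.sum_card
    simp only [List.map_append, List.sum_append, List.map_cons, List.map_nil, List.sum_cons,
      List.sum_nil]
    omega
  · intro M σ hσ v hv m t hm
    rw [List.length_append]
    exact hσ.lt_of_lt_card_anc (h.late M σ hσ) (hbig v hv) hm
  · intro M σ hσ
    obtain ⟨w, hw⟩ := hR
    obtain ⟨m, t, hm⟩ := hσ.all_jobs w
    have h1 := h.late M σ hσ w hw m t hm
    have h2 := le_makespan hm
    simp only [List.length_append, List.length_singleton, add_mul, one_mul]
    omega

theorem partitionGraph_spec {cfg : Config V} {δ : ℝ≥0∞} (hG : Acyclic G) {ρ : ℕ} (hρ : 0 < ρ)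
    (hest : EstimatesAccurate cfg G δ) {fuel : ℕ}
    (hfuel : (Fintype.card V + 1) * Fintype.card V + Fintype.card V ≤ fuel) :
    HoldsExcept (partitionGraph cfg G ρ fuel) (Fintype.card V * δ) (IsPartition G ρ ∅) := by
  have hstart : IsPartition G ρ (univ : Finset V) [] :=
    ⟨fun _ _ h => absurd (mem_univ _) h, trivial, by simp, by simp, by simp,
      fun M σ hσ v _ m t hm => by simpa using Nat.lt_of_succ_le (hσ.time_pos m v t hm), by simp⟩
  have hloop := HoldsExcept.whileLoop (δ := δ)
    (cond := fun st : Finset V × List (Finset V) => st.1.Nonempty)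
    (body := fun st => do
      let nV ← OptionT.lift (estimateV cfg G st.1)
      let q ← buildSmall G ρ nV fuel st.1
      pure (st.1 \ q.2, st.2 ++ [q.2]))
    (fun st => IsPartition G ρ st.1 st.2) (fun st => #st.1) (fun _ _ h => card_pos.2 h)
    (fun st hInv hc => by
      refine ((hest.vertices st.1).bind (δ' := 0) fun nV hnV =>
        ((buildSmall_spec hG ρ nV st.1 (le_trans ?_ hfuel)).bind (δ' := 0) fun q hq =>
          HoldsExcept.pure (hInv.step hG hρ hc hnV hq.1 hq.2.1 hq.2.2)).mono (by simp)
            fun _ h => h).mono (by simp) fun _ h => h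
      have := card_le_univ st.1
      gcongr)
    fuel (univ, []) hstart (by rw [card_univ]; exact le_trans (by omega) hfuel)
  refine (hloop.bind (δ' := 0) fun r hr => HoldsExcept.pure ?_).mono (by simp) fun _ h => h
  have : r.1 = ∅ := not_nonempty_iff_eq_empty.1 hr.2
  exact this ▸ hr.1

end Partition

/-! ### Feasibility and load of list-scheduled batches. -/

section ListScheduling

variable {V : Type*} {G : Digraph V} {M : ℕ}

/-- All predecessors of a job of `block` precede it in `block` or belong to `D`. -/
def ClosedBlock (G : Digraph V) (D : Set V) (block : List V) : Prop :=
  ∀ (i : ℕ) (v : V), block[i]? = some v → ∀ u, G.Adj u v → u ∈ D ∨ ∃ j < i, block[j]? = some u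

/-- What is known about a schedule built after time `start`, with the given machine loads. -/
structure IsBatchSchedule (G : Digraph V) (D : Set V) (start bound : ℕ) (σ : Schedule V M)
    (load : Fin M → ℕ) : Prop where
  time : ∀ m v t, (m, v, t) ∈ σ → start + 1 ≤ t ∧ t ≤ start + load m
  one_at_a_time : ∀ m t u v, (m, u, t) ∈ σ → (m, v, t) ∈ σ → u = v
  precedence : ∀ m v t, (m, v, t) ∈ σ → ∀ u, G.Adj u v → u ∈ D ∨ ∃ t' < t, (m, u, t') ∈ σ
  balanced : ∀ m, M * load m ≤ bound

/-- A feasible schedule of the jobs in `D`, all finished at least `ρ` slots before `clock`. -/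
structure IsPartialSchedule (G : Digraph V) (ρ : ℕ) (D : Set V) (σ : Schedule V M) (clock : ℕ) :
    Prop where
  time : ∀ m v t, (m, v, t) ∈ σ → 1 ≤ t ∧ t + ρ ≤ clock
  jobs : ∀ v ∈ D, ∃ m t, (m, v, t) ∈ σ
  one_at_a_time : ∀ m t u v, (m, u, t) ∈ σ → (m, v, t) ∈ σ → u = v
  precedence : ∀ m v t, (m, v, t) ∈ σ → ∀ u, G.Adj u v →
    (∃ t', (m, u, t') ∈ σ ∧ t' < t) ∨ (∃ m' t', m' ≠ m ∧ (m', u, t') ∈ σ ∧ t' + ρ < t)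

theorem IsPartialSchedule.isFeasible {ρ clock : ℕ} {σ : Schedule V M}
    (h : IsPartialSchedule G ρ Set.univ σ clock) : IsFeasible G ρ σ where
  time_pos m v t hm := (h.time m v t hm).1
  all_jobs v := h.jobs v trivial
  one_at_a_time := h.one_at_a_time
  precedence := h.precedence

theorem IsPartialSchedule.makespan_le {ρ clock : ℕ} {D : Set V} {σ : Schedule V M}
    (h : IsPartialSchedule G ρ D σ clock) : makespan σ ≤ clock :=
  Finset.sup_le fun p hp => by
    have := (h.time p.1 p.2.1 p.2.2 hp).2
    omega

variable [DecidableEq V]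

theorem mem_placeBlock {m m' : Fin M} {s t : ℕ} {v : V} {block : List V} :
    (m', v, t) ∈ placeBlock m s block ↔ m' = m ∧ ∃ i, block[i]? = some v ∧ t = s + i + 1 := by
  simp only [placeBlock, List.mem_toFinset, List.mem_map, Prod.exists, Prod.mk.injEq,
    List.mem_zipIdx_iff_getElem?]
  constructor
  · rintro ⟨w, i, hi, rfl, rfl, rfl⟩
    exact ⟨rfl, i, hi, rfl⟩
  · rintro ⟨rfl, i, hi, rfl⟩
    exact ⟨v, i, hi, rfl, rfl, rfl⟩

theorem IsBatchSchedule.add_block {D : Set V} {start bound : ℕ} {σ : Schedule V M}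
    {load : Fin M → ℕ} (h : IsBatchSchedule G D start bound σ load) {block : List V}
    (hblock : ClosedBlock G D block) (m : Fin M) (hbound : M * (load m + block.length) ≤ bound) :
    IsBatchSchedule G D start bound (σ ∪ placeBlock m (start + load m) block)
      (Function.update load m (load m + block.length)) := by
  have hload : ∀ m', load m' ≤ Function.update load m (load m + block.length) m' := by
    intro m'
    by_cases hm : m' = m
    · subst hm
      simp
    · simp [hm]
  refine ⟨?_, ?_, ?_, ?_⟩
  · intro m' v t hm
    rcases mem_union.1 hm with hm | hm
    · have h1 := h.time m' v t hm
      have h2 := hload m'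
      omega
    · obtain ⟨rfl, i, hi, rfl⟩ := mem_placeBlock.1 hm
      have := (List.getElem?_eq_some_iff.1 hi).1
      simp only [Function.update_self]
      omega
  · intro m' t u v hu hv
    rcases mem_union.1 hu with hu' | hu' <;> rcases mem_union.1 hv with hv' | hv'
    · exact h.one_at_a_time m' t u v hu' hv'
    · obtain ⟨rfl, i, hi, rfl⟩ := mem_placeBlock.1 hv'
      have := h.time _ _ _ hu'
      omega
    · obtain ⟨rfl, i, hi, rfl⟩ := mem_placeBlock.1 hu'
      have := h.time _ _ _ hv'
      omega
    · obtain ⟨-, i, hi, hti⟩ := mem_placeBlock.1 hu'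
      obtain ⟨-, j, hj, htj⟩ := mem_placeBlock.1 hv'
      obtain rfl : i = j := by omega
      rw [hi] at hj
      exact Option.some.inj hj
  · intro m' v t hm u huv
    rcases mem_union.1 hm with hm | hm
    · rcases h.precedence m' v t hm u huv with h1 | ⟨t', ht', h1⟩
      · exact .inl h1
      · exact .inr ⟨t', ht', mem_union_left _ h1⟩
    · obtain ⟨rfl, i, hi, rfl⟩ := mem_placeBlock.1 hm
      rcases hblock i v hi u huv with h1 | ⟨j, hj, h1⟩
      · exact .inl h1
      · exact .inr ⟨start + load m' + j + 1, by omega,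
          mem_union_right _ (mem_placeBlock.2 ⟨rfl, j, h1, rfl⟩)⟩
  · intro m'
    by_cases hm : m' = m
    · subst hm
      simpa using hbound
    · simpa [hm] using h.balanced m'

/-- The minimum is at most the average. Hence a machine's load never exceeds the average load plus
one longest block, as in Graham's bound. -/
theorem leastLoaded_le [NeZero M] (load : Fin M → ℕ) : M * load (leastLoaded load) ≤ ∑ m, load m := by
  have h := Classical.choose_spec (Finite.exists_min load)
  have := card_nsmul_le_sum univ load (load (leastLoaded load)) fun m _ => h m
  simpa using this

theorem listSchedule_spec [NeZero M] {D : Set V} {start maxLen total : ℕ} (blocks : List (List V))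
    (hclosed : ∀ b ∈ blocks, ClosedBlock G D b) (hlen : ∀ b ∈ blocks, b.length ≤ maxLen)
    (htotal : (blocks.map List.length).sum ≤ total) :
    ∃ load, IsBatchSchedule G D start (total + M * maxLen) (listSchedule M start blocks).1 load ∧
      (listSchedule M start blocks).2 = univ.sup load ∧
      ∀ b ∈ blocks, ∀ v ∈ b, ∃ m t, (m, v, t) ∈ (listSchedule M start blocks).1 := by
  have key : ∀ (blocks : List (List V)) (st : Schedule V M × (Fin M → ℕ)),
      (∀ b ∈ blocks, ClosedBlock G D b) → (∀ b ∈ blocks, b.length ≤ maxLen) →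
      ∑ m, st.2 m + (blocks.map List.length).sum ≤ total →
      IsBatchSchedule G D start (total + M * maxLen) st.1 st.2 →
      ∃ r, r = blocks.foldl (fun (st : Schedule V M × (Fin M → ℕ)) block =>
        let m := leastLoaded st.2
        (st.1 ∪ placeBlock m (start + st.2 m) block,
          Function.update st.2 m (st.2 m + block.length))) st ∧
        IsBatchSchedule G D start (total + M * maxLen) r.1 r.2 ∧ st.1 ⊆ r.1 ∧
        ∀ b ∈ blocks, ∀ v ∈ b, ∃ m t, (m, v, t) ∈ r.1 := by
    intro blocks
    induction blocks with
    | nil => exact fun st _ _ _ h => ⟨st, rfl, h, subset_rfl, by simp⟩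
    | cons b blocks ih =>
      intro st hclosed hlen htotal h
      have hb := hlen b (by simp)
      have hleast := leastLoaded_le st.2
      rw [List.map_cons, List.sum_cons] at htotal
      have hbound : M * (st.2 (leastLoaded st.2) + b.length) ≤ total + M * maxLen := by
        rw [mul_add]
        have := Nat.mul_le_mul_left M hb
        omega
      have hstep := h.add_block (hclosed b (by simp)) (leastLoaded st.2) hbound
      have hsum : ∑ m, Function.update st.2 (leastLoaded st.2)
          (st.2 (leastLoaded st.2) + b.length) m = ∑ m, st.2 m + b.length := by
        rw [sum_update_of_mem (mem_univ _), ← add_sum_erase univ st.2 (mem_univ (leastLoaded st.2)),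
          sdiff_singleton_eq_erase]
        omega
      obtain ⟨r, hr, h1, h2, h3⟩ := ih
        (st.1 ∪ placeBlock (leastLoaded st.2) (start + st.2 (leastLoaded st.2)) b,
          Function.update st.2 (leastLoaded st.2) (st.2 (leastLoaded st.2) + b.length))
        (fun b' hb' => hclosed b' (by simp [hb'])) (fun b' hb' => hlen b' (by simp [hb']))
        (by simp only [hsum]; omega) hstep
      refine ⟨r, hr, h1, subset_union_left.trans h2, fun b' hb' v hv => ?_⟩
      rcases List.mem_cons.1 hb' with rfl | hb'
      · obtain ⟨i, hi⟩ := List.mem_iff_getElem?.1 hv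
        exact ⟨_, _, h2 (mem_union_right _ (mem_placeBlock.2 ⟨rfl, i, hi, rfl⟩))⟩
      · exact h3 b' hb' v hv
  obtain ⟨r, hr, h1, -, h3⟩ := key blocks (∅, fun _ => 0) hclosed hlen (by simpa using htotal)
    ⟨by simp, by simp, by simp, by simp⟩
  have hls : listSchedule M start blocks = (r.1, univ.sup r.2) := by rw [hr]; rfl
  rw [hls]
  exact ⟨r.2, h1, rfl, h3⟩

theorem mul_sup_le {bound : ℕ} {load : Fin M → ℕ} (h : ∀ m, M * load m ≤ bound) :
    M * univ.sup load ≤ bound := by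
  rcases (univ : Finset (Fin M)).eq_empty_or_nonempty with h0 | h0
  · simp [h0]
  · obtain ⟨m, -, hm⟩ := exists_mem_eq_sup univ h0 load
    exact hm ▸ h m

/-- An ancestor set contains all predecessors inside `S` of its members, and sorting by ancestor
count puts these strictly earlier. Duplication thus makes each block independent of the others in
its batch. -/
theorem closedBlock_topoSort (hG : Acyclic G) {S : Finset V} {D : Set V}
    (hS : ∀ v ∈ S, ∀ u, G.Adj u v → u ∈ S ∨ u ∈ D) (v : V) :
    ClosedBlock G D (topoSort G S (anc G S v)) := by
  intro i w hw u huw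
  have hwv : w ∈ anc G S v := mem_topoSort.1 (List.mem_of_getElem? hw)
  rcases hS w (anc_subset hwv) u huw with hu | hu
  · right
    have hup : u ∈ pred G S w := mem_pred.2 ⟨hu, huw⟩
    have huv : u ∈ anc G S v := anc_subset_anc hwv (pred_subset_anc (anc_subset hwv) hup)
    obtain ⟨j, hj⟩ := List.mem_iff_getElem?.1 (mem_topoSort.2 huv)
    refine ⟨j, ?_, hj⟩
    by_contra hle
    push Not at hle
    rcases hle.eq_or_lt with rfl | hlt
    · rw [hw] at hj
      exact hG.not_adj_self (Option.some.inj hj ▸ huw)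
    · obtain ⟨hi', rfl⟩ := List.getElem?_eq_some_iff.1 hw
      obtain ⟨hj', rfl⟩ := List.getElem?_eq_some_iff.1 hj
      have := List.pairwise_iff_getElem.1 (pairwise_topoSort (G := G) (S := S) (anc G S v))
        i j hi' hj' hlt
      exact absurd (hG.card_anc_lt_of_pred (anc_subset hwv) hup) (by omega)
  · exact .inl hu

/-- Adding one batch to a partial schedule. -/
theorem IsPartialSchedule.add_batch [NeZero M] (hG : Acyclic G) {ρ clock maxLen : ℕ} {D D' : Set V}
    {σ : Schedule V M} (h : IsPartialSchedule G ρ D σ clock) {S : Finset V}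
    (hS : ∀ v ∈ S, ∀ u, G.Adj u v → u ∈ S ∨ u ∈ D) (hlen : ∀ v ∈ S, #(anc G S v) ≤ maxLen)
    (B : List V) (hB : ∀ v ∈ B, v ∈ S) (hD' : D' ⊆ D ∪ ancOf G S B) :
    let L := listSchedule M clock (B.map fun v => topoSort G S (anc G S v))
    IsPartialSchedule G ρ D' (σ ∪ L.1) (clock + L.2 + ρ) ∧
      M * L.2 ≤ (B.map fun v => #(anc G S v)).sum + M * maxLen := by
  intro L
  obtain ⟨load, hL, hload, hjobs⟩ := listSchedule_spec (M := M) (G := G) (D := D) (start := clock)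
    (maxLen := maxLen) (total := (B.map fun v => #(anc G S v)).sum)
    (B.map fun v => topoSort G S (anc G S v))
    (by simpa using fun v _ => closedBlock_topoSort hG hS v)
    (by simpa [length_topoSort] using fun v hv => hlen v (hB v hv))
    (by simp [Function.comp_def, length_topoSort])
  change IsBatchSchedule G D clock _ L.1 load at hL
  change L.2 = _ at hload
  refine ⟨⟨?_, ?_, ?_, ?_⟩, by rw [hload]; exact mul_sup_le hL.balanced⟩
  · intro m v t hm
    rcases mem_union.1 hm with hm | hm
    · have := h.time m v t hm
      omega
    · have h1 := hL.time m v t hm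
      have h2 : load m ≤ univ.sup load := le_sup (mem_univ m)
      omega
  · intro v hv
    rcases hD' hv with hv | hv
    · obtain ⟨m, t, hm⟩ := h.jobs v hv
      exact ⟨m, t, mem_union_left _ hm⟩
    · obtain ⟨w, hw, hvw⟩ := mem_ancOf.1 (mem_coe.1 hv)
      obtain ⟨m, t, hm⟩ := hjobs _ (List.mem_map.2 ⟨w, hw, rfl⟩) v (mem_topoSort.2 hvw)
      exact ⟨m, t, mem_union_right _ hm⟩
  · intro m t u v hu hv
    rcases mem_union.1 hu with hu | hu <;> rcases mem_union.1 hv with hv | hv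
    · exact h.one_at_a_time m t u v hu hv
    · have h1 := h.time _ _ _ hu
      have h2 := hL.time _ _ _ hv
      omega
    · have h1 := h.time _ _ _ hv
      have h2 := hL.time _ _ _ hu
      omega
    · exact hL.one_at_a_time m t u v hu hv
  · intro m v t hm u huv
    rcases mem_union.1 hm with hm | hm
    · rcases h.precedence m v t hm u huv with ⟨t', h1, h2⟩ | ⟨m', t', h1, h2, h3⟩
      · exact .inl ⟨t', mem_union_left _ h1, h2⟩
      · exact .inr ⟨m', t', h1, mem_union_left _ h2, h3⟩
    · rcases hL.precedence m v t hm u huv with hu | ⟨t', h1, h2⟩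
      · obtain ⟨m', t', hm'⟩ := h.jobs u hu
        have h1 := h.time _ _ _ hm'
        have h2 := hL.time _ _ _ hm
        by_cases hmm : m' = m
        · exact .inl ⟨t', mem_union_left _ (hmm ▸ hm'), by omega⟩
        · exact .inr ⟨m', t', hmm, mem_union_left _ hm', by omega⟩
      · exact .inl ⟨t', mem_union_right _ h2, h1⟩

end ListScheduling

/-! ### Batches: little overlap, and large shrinkage of what remains. -/

section Batches

variable {V : Type*} [DecidableEq V] {G : Digraph V}

/-- After the removal of the ancestors of `B`, only a `4γ`-fraction of the ancestors of `v`, or of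
the edges that they induce, is left. -/
def Shrunk (G : Digraph V) (S : Finset V) (γ : ℝ) (B : List V) (v : V) : Prop :=
  (#(anc G (S \ ancOf G S B) v) : ℝ) ≤ 4 * γ * #(anc G S v) ∨
    0 < #(edgesIn G (anc G S v)) ∧
      (#(edgesIn G (anc G (S \ ancOf G S B) v)) : ℝ) ≤ 4 * γ * #(edgesIn G (anc G S v))

variable {S : Finset V} {γ : ℝ} {B B' : List V} {v : V}

/-- This lets a job found stale be discarded for good while the batch keeps growing. -/
theorem Shrunk.mono (h : Shrunk G S γ B v) (hB : B ⊆ B') : Shrunk G S γ B' v := by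
  have hsub : S \ ancOf G S B' ⊆ S \ ancOf G S B := sdiff_subset_sdiff subset_rfl (ancOf_mono hB)
  refine h.imp (le_trans ?_) (And.imp_right (le_trans ?_))
  · exact_mod_cast card_le_card (anc_mono hsub)
  · exact_mod_cast card_le_card (edgesIn_mono (anc_mono hsub))

theorem shrunk_of_not_fresh (hγ : 0 ≤ γ) (h : ¬ Fresh G S γ B v) : Shrunk G S γ B v := by
  rw [Fresh, not_and_or] at h
  rcases h with h | h
  · left
    push Not at h
    have h1 : (#(anc G (S \ ancOf G S B) v) : ℝ) ≤ #(anc G S v \ ancOf G S B) := by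
      exact_mod_cast card_le_card (anc_sdiff_subset B)
    have h2 : 0 ≤ γ * #(anc G S v) := by positivity
    linarith
  · right
    push Not at h
    obtain ⟨hne, h⟩ := h
    have h1 : (#(edgesIn G (anc G (S \ ancOf G S B) v)) : ℝ) ≤
        #(edgesIn G (anc G S v) \ edgesIn G (ancOf G S B)) := by
      exact_mod_cast card_le_card (edgesIn_anc_sdiff_subset B)
    have h2 : 0 ≤ γ * #(edgesIn G (anc G S v)) := by positivity
    exact ⟨card_pos.2 hne, by linarith⟩

/-- Guarantees progress: a batch covering nothing would leave every job unshrunk, contradicting what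
`findBatch` ensures. -/
theorem not_shrunk (hγ : 4 * γ < 1) (hB : ancOf G S B = ∅) (hv : v ∈ S) : ¬ Shrunk G S γ B v := by
  have h0 : (0 : ℝ) < #(anc G S v) := by
    exact_mod_cast card_pos.2 ⟨v, self_mem_anc hv⟩
  rw [Shrunk, hB, sdiff_empty]
  rintro (h | ⟨h1, h⟩)
  · nlinarith
  · have h1 : (0 : ℝ) < #(edgesIn G (anc G S v)) := by exact_mod_cast h1
    nlinarith

/-- The batch consists of jobs of `S`, and its ancestor sets overlap little. -/
structure IsBatch (G : Digraph V) (S : Finset V) (γ : ℝ) (B : List V) : Prop where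
  mem : ∀ v ∈ B, v ∈ S
  weight : γ * (B.map fun v => #(anc G S v)).sum ≤ #(ancOf G S B)

/-- The uncovered ancestors of a fresh job are new to the union and number more than γ times its
block, so they pay for it. -/
theorem IsBatch.append (h : IsBatch G S γ B) (hv : v ∈ S) (hf : Fresh G S γ B v) :
    IsBatch G S γ (B ++ [v]) := by
  refine ⟨fun w hw => ?_, ?_⟩
  · rcases List.mem_append.1 hw with hw | hw
    · exact h.mem w hw
    · exact List.mem_singleton.1 hw ▸ hv
  · have h1 : ancOf G S (B ++ [v]) = ancOf G S B ∪ (anc G S v \ ancOf G S B) := by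
      ext u
      simp only [mem_ancOf, List.mem_append, List.mem_singleton, mem_union, mem_sdiff]
      constructor
      · rintro ⟨w, hw | rfl, hu⟩
        · exact .inl ⟨w, hw, hu⟩
        · by_cases hB : ∃ w ∈ B, u ∈ anc G S w
          · exact .inl hB
          · exact .inr ⟨hu, hB⟩
      · rintro (⟨w, hw, hu⟩ | ⟨hu, -⟩)
        · exact ⟨w, .inl hw, hu⟩
        · exact ⟨v, .inr rfl, hu⟩
    rw [h1, card_union_of_disjoint disjoint_sdiff]
    have h2 := h.weight
    have h3 := hf.1
    simp only [List.map_append, List.sum_append, List.map_cons, List.map_nil, List.sum_cons,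
      List.sum_nil, Nat.cast_add]
    push_cast at *
    linarith

theorem uniformOfFinset_mem {α : Type*} {K : Finset α} (hK : K.Nonempty) :
    HoldsExcept (OptionT.lift (PMF.uniformOfFinset K hK)) 0 (· ∈ K) := by
  refine HoldsExcept.lift (le_of_eq ?_)
  rw [PMF.toOuterMeasure_uniformOfFinset_apply, ENNReal.div_eq_zero_iff, Nat.cast_eq_zero,
    card_eq_zero, eq_empty_iff_forall_notMem]
  exact .inl fun x hx => by simp at hx

/-- True for every outcome of the sampling, hence failure bound 0. Jobs left when the stale counter
stops the loop simply stay in the bucket. -/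
theorem sampleBucket_spec (hγ : 0 ≤ γ) {N fuel : ℕ} (hN : 0 < N) {K : Finset V} (hK : K ⊆ S)
    (hB : IsBatch G S γ B) (hfuel : #K ≤ fuel) :
    HoldsExcept (sampleBucket G S γ N fuel K B) 0 fun r => r.2.1 ⊆ K ∧ B ⊆ r.2.2 ∧
      IsBatch G S γ r.2.2 ∧ (∀ v ∈ K, v ∈ r.2.1 ∨ v ∈ r.2.2 ∨ Shrunk G S γ r.2.2 v) ∧
      (K.Nonempty → ∃ v ∈ K, v ∉ r.2.1) := by
  refine (HoldsExcept.whileLoop (δ := 0)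
    (fun r => r.2.1 ⊆ K ∧ B ⊆ r.2.2 ∧ IsBatch G S γ r.2.2 ∧
      (∀ v ∈ K, v ∈ r.2.1 ∨ v ∈ r.2.2 ∨ Shrunk G S γ r.2.2 v) ∧
      (r.1 = 0 ∨ ∃ v ∈ K, v ∉ r.2.1)) (fun r => #r.2.1)
    (fun r _ hc => card_pos.2 hc.2) ?_ fuel (0, K, B)
    ⟨subset_rfl, List.Subset.refl _, hB, fun v hv => .inl hv, .inl rfl⟩ hfuel).mono (by simp) ?_
  · rintro ⟨cnt, K', B'⟩ ⟨hKK, hBB, hB', hall, -⟩ ⟨-, hne⟩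
    simp only at hKK hBB hB' hall hne ⊢
    classical
    rw [dif_pos hne]
    refine ((uniformOfFinset_mem hne).bind (δ' := 0) fun v hv => ?_).mono (by simp) fun _ h => h
    have hcard : #(K'.erase v) < #K' := card_erase_lt_of_mem hv
    have hsub : K'.erase v ⊆ K := (erase_subset _ _).trans hKK
    have hex : ∃ w ∈ K, w ∉ K'.erase v := ⟨v, hKK hv, notMem_erase _ _⟩
    refine HoldsExcept.ite (fun hf => HoldsExcept.pure ?_) fun hf => HoldsExcept.pure ?_
    · refine ⟨⟨hsub, fun w hw => List.mem_append_left _ (hBB hw), hB'.append (hK (hKK hv)) hf,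
        fun w hw => ?_, .inr hex⟩, hcard⟩
      by_cases hwv : w = v
      · exact .inr (.inl (by simp [hwv]))
      · rcases hall w hw with h | h | h
        · exact .inl (mem_erase.2 ⟨hwv, h⟩)
        · exact .inr (.inl (List.mem_append_left _ h))
        · exact .inr (.inr (h.mono fun x hx => List.mem_append_left _ hx))
    · refine ⟨⟨hsub, hBB, hB', fun w hw => ?_, .inr hex⟩, hcard⟩
      by_cases hwv : w = v
      · subst hwv
        exact .inr (.inr (shrunk_of_not_fresh hγ hf))
      · exact (hall w hw).imp_left fun h => mem_erase.2 ⟨hwv, h⟩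
  · rintro ⟨cnt, K', B'⟩ ⟨⟨h1, h2, h3, h4, h5⟩, hc⟩
    refine ⟨h1, h2, h3, h4, fun hne => ?_⟩
    simp only [not_and, not_nonempty_iff_eq_empty] at hc h5 ⊢
    rcases h5 with h5 | h5
    -- With counter 0 < N the loop can only have stopped on an empty bucket.
    · rw [hc (h5 ▸ hN)]
      exact ⟨_, hne.choose_spec, notMem_empty _⟩
    · exact h5

/-- The invariant of the search for a batch: jobs are in a bucket, in the batch, or shrunk. -/
structure BatchInvariant (G : Digraph V) (S : Finset V) (γ : ℝ) (top : ℕ)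
    (st : (ℕ → Finset V) × List V) : Prop where
  batch : IsBatch G S γ st.2
  subset : ∀ i, st.1 i ⊆ S
  empty : ∀ i, top < i → st.1 i = ∅
  all : ∀ v ∈ S, (∃ i, v ∈ st.1 i) ∨ v ∈ st.2 ∨ Shrunk G S γ st.2 v

theorem sampleBuckets_spec (hγ : 0 ≤ γ) {N fuel top : ℕ} (hN : 0 < N) (hfuel : #S ≤ fuel) :
    ∀ (l : List ℕ) (st : (ℕ → Finset V) × List V), BatchInvariant G S γ top st →
      HoldsExcept (l.foldlM (fun (st : (ℕ → Finset V) × List V) i => do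
          let r ← sampleBucket G S γ N fuel (st.1 i) st.2
          pure (Function.update st.1 i r.2.1, r.2.2)) st) 0 fun r =>
        BatchInvariant G S γ top r ∧ (∀ i, r.1 i ⊆ st.1 i) ∧
          ∀ i ∈ l, (st.1 i).Nonempty → ∃ v ∈ st.1 i, v ∉ r.1 i := by
  intro l
  induction l with
  | nil => exact fun st h => HoldsExcept.pure ⟨h, fun _ => subset_rfl, by simp⟩
  | cons i l ih =>
    intro st h
    rw [List.foldlM_cons, bind_assoc]
    refine ((sampleBucket_spec hγ hN (h.subset i) h.batch
      ((card_le_card (h.subset i)).trans hfuel)).bind (δ' := 0) fun r hr => ?_).mono (by simp)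
        fun _ h => h
    obtain ⟨h1, h2, h3, h4, h5⟩ := hr
    rw [pure_bind]
    have hsub : ∀ j, Function.update st.1 i r.2.1 j ⊆ st.1 j := by
      intro j
      by_cases hj : j = i
      · subst hj
        simpa using h1
      · simp [hj]
    refine (ih (Function.update st.1 i r.2.1, r.2.2) ⟨h3, fun j => (hsub j).trans (h.subset j),
      fun j hj => subset_empty.1 (h.empty j hj ▸ hsub j), fun v hv => ?_⟩).mono le_rfl ?_
    · rcases h.all v hv with ⟨j, hj⟩ | hvB | hvS
      · by_cases hji : j = i
        · subst hji
          rcases h4 v hj with h | h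
          · exact .inl ⟨j, by simpa using h⟩
          · exact .inr h
        · exact .inl ⟨j, by simpa [hji] using hj⟩
      · exact .inr (.inl (h2 hvB))
      · exact .inr (.inr (hvS.mono h2))
    · rintro r' ⟨g1, g2, g3⟩
      refine ⟨g1, fun j => (g2 j).trans (hsub j), fun j hj hne => ?_⟩
      by_cases hji : j = i
      · subst hji
        obtain ⟨v, hv, hv'⟩ := h5 hne
        refine ⟨v, hv, fun h => hv' ?_⟩
        simpa using g2 j h
      · have := g3 j ((List.mem_cons.1 hj).resolve_left hji)
        simp only [Function.update_of_ne hji] at this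
        exact this hne

variable [Fintype V] {cfg : Config V} {δ : ℝ≥0∞}

/-- The quotient of two estimates is off by at most (4/3)/(2/3) = 2, so a measured ratio of 2γ means
a true ratio of at most 4γ. -/
theorem Accurate.le_of_div_le {x x' : ℝ} {s s' : ℕ} (h : Accurate x s) (h' : Accurate x' s')
    (hs : 0 < s) (hγ : 0 ≤ γ) (hle : x' / x ≤ 2 * γ) : (s' : ℝ) ≤ 4 * γ * s := by
  have hsR : (0 : ℝ) < s := by exact_mod_cast hs
  have hx : 0 < x := lt_of_lt_of_le (by positivity) h.1
  rw [div_le_iff₀ hx] at hle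
  have h1 := h'.1
  have h2 := mul_le_mul_of_nonneg_left h.2 hγ
  linarith

theorem prune_spec (hγ : 0 ≤ γ) (hest : EstimatesAccurate cfg G δ) {top : ℕ}
    {st : (ℕ → Finset V) × List V} (h : BatchInvariant G S γ top st) :
    HoldsExcept (prune cfg G S γ st.2 st.1) (4 * δ) fun K =>
      BatchInvariant G S γ top (K, st.2) ∧ ∀ i, K i ⊆ st.1 i := by
  refine ((hest.vertices S).bind (δ' := δ + (δ + δ)) fun nV hV => (hest.edges S).bind fun nE hE =>
    (hest.vertices _).bind fun nV' hV' => ((hest.edges _).bind (δ' := 0) fun nE' hE' =>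
      HoldsExcept.pure ?_).mono (by simp) fun _ h => h).mono (le_of_eq (by ring)) fun _ h => h
  refine ⟨⟨h.batch, fun i => (filter_subset _ _).trans (h.subset i), fun i hi => ?_, fun v hv => ?_⟩,
    fun i => filter_subset _ _⟩
  · simp only [h.empty i hi, filter_empty]
  · rcases h.all v hv with ⟨i, hi⟩ | hv
    · by_cases hc : nV' v / nV v ≤ 2 * γ ∨ (nE v ≠ 0 ∧ nE' v / nE v ≤ 2 * γ)
      · right
        right
        rcases hc with hc | ⟨hne, hc⟩
        · exact .inl ((hV v).le_of_div_le (hV' v) (card_pos.2 ⟨v, self_mem_anc hv⟩) hγ hc)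
        · have hpos : 0 < #(edgesIn G (anc G S v)) := by
            by_contra h0
            have h1 := hE v
            rw [Nat.eq_zero_of_not_pos h0, Accurate] at h1
            norm_num at h1
            exact hne (le_antisymm h1.2 h1.1)
          exact .inr ⟨hpos, (hE v).le_of_div_le (hE' v) hpos hγ hc⟩
      · exact .inl ⟨i, mem_filter.2 ⟨hi, hc⟩⟩
    · exact .inr hv

/-- The first edge estimate only distributes jobs over buckets, so its accuracy is not required.
Each round removes a job from every non-empty bucket, so there are at most n rounds, with four
estimates each. -/
theorem findBatch_spec (hγ : 0 ≤ γ) (hest : EstimatesAccurate cfg G δ) {fuel : ℕ}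
    (hfuel : Fintype.card V ≤ fuel) :
    HoldsExcept (findBatch cfg G γ fuel S) (Fintype.card V * (4 * δ)) fun B =>
      IsBatch G S γ B ∧ ∀ v ∈ S, v ∈ ancOf G S B ∨ Shrunk G S γ B v := by
  have hS : #S ≤ Fintype.card V := card_le_univ S
  refine ((HoldsExcept.lift (δ := 0) (Q := fun _ => True) (by simp)).bind
    (δ' := Fintype.card V * (4 * δ)) fun nE _ => ?_).mono (by simp) fun _ h => h
  set top := S.sup fun v => bucketIndex (nE v) with htop
  have hidx : ∀ v ∈ S, bucketIndex (nE v) ≤ top := fun v hv =>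
    le_sup (f := fun v => bucketIndex (nE v)) hv
  have h0 : BatchInvariant G S γ top ((fun i => S.filter fun v => bucketIndex (nE v) = i), []) := by
    refine ⟨⟨by simp, by simp⟩, fun i => filter_subset _ _, fun i hi => ?_,
      fun v hv => .inl ⟨_, mem_filter.2 ⟨hv, rfl⟩⟩⟩
    exact filter_false_of_mem fun v hv hvi => by
      have := hidx v hv
      omega
  have hm0 : ∑ i ∈ range (top + 1), #(S.filter fun v => bucketIndex (nE v) = i) = #S :=
    (card_eq_sum_card_fiberwise fun v hv => by
      have := hidx v hv
      simp
      omega).symm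
  refine ((HoldsExcept.whileLoop (δ := 4 * δ) (BatchInvariant G S γ top)
    (fun st => ∑ i ∈ range (top + 1), #(st.1 i)) ?_ ?_ fuel _ h0 ?_).bind (δ' := 0)
      fun r hr => HoldsExcept.pure ?_).mono ?_ fun _ h => h
  · rintro st hst ⟨i, hi⟩
    refine (card_pos.2 hi).trans_le (single_le_sum (f := fun i => #(st.1 i))
      (fun _ _ => Nat.zero_le _) (mem_range.2 ?_))
    by_contra hlt
    rw [hst.empty i (by omega)] at hi
    exact not_nonempty_empty hi
  · rintro st hst ⟨i, hi⟩
    have hitop : i < top + 1 := by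
      by_contra hlt
      rw [hst.empty i (by omega)] at hi
      exact not_nonempty_empty hi
    refine ((sampleBuckets_spec hγ (logCount_pos _ _) (hS.trans hfuel) _ st hst).bind
      (δ' := 4 * δ) fun st' hst' => ((prune_spec hγ hest hst'.1).bind (δ' := 0) fun K hK =>
        HoldsExcept.pure ⟨hK.1, ?_⟩).mono (by simp) fun _ h => h).mono (by simp) fun _ h => h
    have hsub : ∀ j, K j ⊆ st.1 j := fun j => (hK.2 j).trans (hst'.2.1 j)
    refine sum_lt_sum (fun j _ => card_le_card (hsub j)) ⟨i, mem_range.2 hitop, ?_⟩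
    obtain ⟨v, hv, hv'⟩ := hst'.2.2 i (by simpa using hitop) hi
    exact card_lt_card ⟨hsub i, fun h => hv' (hK.2 i (h hv))⟩
  · simp only [hm0]
    exact hS.trans hfuel
  · obtain ⟨hr, hc⟩ := hr
    refine ⟨hr.batch, fun v hv => ?_⟩
    rcases hr.all v hv with ⟨i, hi⟩ | h | h
    · exact absurd ⟨i, v, hi⟩ hc
    · exact .inl (mem_ancOf.2 ⟨v, h, self_mem_anc hv⟩)
    · exact .inr h
  · simp only [hm0, add_zero]
    gcongr

end Batches

/-! ### The potential argument and the total length. -/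

section Analysis

variable {V : Type*} [DecidableEq V] {G : Digraph V} {S H : Finset V} {γ : ℝ} {B : List V} {v : V}

/-- The number of edges induced by the ancestors of `v`, or `4γ` if there are none. -/
noncomputable def edgeWeight (G : Digraph V) (γ : ℝ) (S : Finset V) (v : V) : ℝ :=
  if #(edgesIn G (anc G S v)) = 0 then 4 * γ else #(edgesIn G (anc G S v))

/-- A quantity that drops by a factor `4γ` with every batch. -/
noncomputable def potential (G : Digraph V) (γ : ℝ) (S : Finset V) (v : V) : ℝ :=
  #(anc G S v) * edgeWeight G γ S v

theorem le_edgeWeight (hγ1 : 4 * γ < 1) : 4 * γ ≤ edgeWeight G γ S v := by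
  rw [edgeWeight]
  split_ifs with h
  · exact le_rfl
  · have : (1 : ℝ) ≤ #(edgesIn G (anc G S v)) := by exact_mod_cast Nat.one_le_iff_ne_zero.2 h
    linarith

theorem edgeWeight_mono (hγ1 : 4 * γ < 1) {S' : Finset V} (h : S' ⊆ S) :
    edgeWeight G γ S' v ≤ edgeWeight G γ S v := by
  have hle : #(edgesIn G (anc G S' v)) ≤ #(edgesIn G (anc G S v)) :=
    card_le_card (edgesIn_mono (anc_mono h))
  by_cases h0 : #(edgesIn G (anc G S' v)) = 0
  · rw [edgeWeight, if_pos h0]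
    exact le_edgeWeight hγ1
  · rw [edgeWeight, if_neg h0, edgeWeight, if_neg (by omega)]
    exact_mod_cast hle

theorem le_potential (hγ : 0 < γ) (hγ1 : 4 * γ < 1) (hv : v ∈ S) : 4 * γ ≤ potential G γ S v := by
  have h1 : (1 : ℝ) ≤ #(anc G S v) := by exact_mod_cast card_pos.2 ⟨v, self_mem_anc hv⟩
  have h2 : 4 * γ ≤ edgeWeight G γ S v := le_edgeWeight hγ1
  rw [potential]
  nlinarith

/-- At most 2ρ ancestors induce at most (2ρ)² edges, and the default weight 4γ < 1 is smaller than
that. -/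
theorem potential_le (hγ1 : 4 * γ < 1) {ρ : ℕ} (hρ : 0 < ρ) (h : #(anc G S v) ≤ 2 * ρ) :
    potential G γ S v ≤ 8 * (ρ : ℝ) ^ 3 := by
  have hρR : (1 : ℝ) ≤ ρ := by exact_mod_cast hρ
  have h1 : (#(anc G S v) : ℝ) ≤ 2 * ρ := by exact_mod_cast h
  have h2 : edgeWeight G γ S v ≤ 4 * (ρ : ℝ) ^ 2 := by
    rw [edgeWeight]
    split_ifs
    · nlinarith
    · have h3 : (#(edgesIn G (anc G S v)) : ℝ) ≤ (#(anc G S v) : ℝ) ^ 2 := by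
        exact_mod_cast card_edgesIn_le _
      nlinarith [pow_le_pow_left₀ (Nat.cast_nonneg _) h1 2]
  calc potential G γ S v ≤ #(anc G S v) * (4 * (ρ : ℝ) ^ 2) :=
        mul_le_mul_of_nonneg_left h2 (Nat.cast_nonneg _)
    _ ≤ 2 * ρ * (4 * (ρ : ℝ) ^ 2) := by gcongr
    _ = 8 * (ρ : ℝ) ^ 3 := by ring

/-- One factor drops by 4γ while the other does not grow. The default edge weight 4γ covers the case
where all edges vanish: a count of at least 1 falls to 4γ, so the product still drops as claimed and
stays positive. -/
theorem Shrunk.potential_le (h : Shrunk G S γ B v) (hγ : 0 < γ) (hγ1 : 4 * γ < 1) :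
    potential G γ (S \ ancOf G S B) v ≤ 4 * γ * potential G γ S v := by
  have hw : edgeWeight G γ (S \ ancOf G S B) v ≤ edgeWeight G γ S v :=
    edgeWeight_mono hγ1 sdiff_subset
  have hw0 : 4 * γ ≤ edgeWeight G γ (S \ ancOf G S B) v := le_edgeWeight hγ1
  have hA : (#(anc G (S \ ancOf G S B) v) : ℝ) ≤ #(anc G S v) := by
    exact_mod_cast card_le_card (anc_mono sdiff_subset)
  rw [potential, potential]
  rcases h with h | ⟨hpos, h⟩
  · calc _ ≤ 4 * γ * #(anc G S v) * edgeWeight G γ S v :=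
          mul_le_mul h hw (by linarith) (by positivity)
      _ = _ := by ring
  · have h1 : edgeWeight G γ (S \ ancOf G S B) v ≤ 4 * γ * edgeWeight G γ S v := by
      have h2 : edgeWeight G γ S v = #(edgesIn G (anc G S v)) := if_neg hpos.ne'
      have h3 : (1 : ℝ) ≤ #(edgesIn G (anc G S v)) := by exact_mod_cast hpos
      rw [h2, edgeWeight]
      split_ifs
      · nlinarith
      · exact h
    calc _ ≤ #(anc G S v) * (4 * γ * edgeWeight G γ S v) :=
          mul_le_mul hA h1 (by linarith) (by positivity)
      _ = _ := by ring

variable {M : ℕ} [NeZero M] {ρ β : ℕ}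

/-- The invariant of the loop over the batches of the layer `H`, after `b` batches. -/
structure LayerInvariant (G : Digraph V) (ρ : ℕ) (γ : ℝ) (D : Set V) (H : Finset V) (clock b : ℕ)
    (st : Finset V × Schedule V M × ℕ) : Prop where
  subset : st.1 ⊆ H
  closed : ∀ v ∈ st.1, ∀ u, G.Adj u v → u ∈ st.1 ∨ u ∈ D ∪ ↑(H \ st.1)
  schedule : IsPartialSchedule G ρ (D ∪ ↑(H \ st.1)) st.2.1 st.2.2
  potential : ∀ v ∈ st.1, potential G γ st.1 v ≤ (4 * γ) ^ b * (8 * (ρ : ℝ) ^ 3)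
  clock_le : γ * (M * st.2.2) ≤ γ * (M * clock) + #(H \ st.1) + γ * (M * (3 * ρ * b))

/-- In the clock estimate, the total block size is paid by the jobs removed, and 3ρ is the longest
block 2ρ plus the delay ρ. -/
theorem LayerInvariant.step (hG : Acyclic G) (hγ : 0 < γ) (hγ1 : 4 * γ < 1) {D : Set V}
    (hH : ∀ v ∈ H, #(anc G H v) ≤ 2 * ρ) {clock b : ℕ} {st : Finset V × Schedule V M × ℕ}
    (h : LayerInvariant G ρ γ D H clock b st) (hB : IsBatch G st.1 γ B)
    (hshrunk : ∀ v ∈ st.1, v ∈ ancOf G st.1 B ∨ Shrunk G st.1 γ B v) :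
    let L := listSchedule M st.2.2 (B.map fun v => topoSort G st.1 (anc G st.1 v))
    LayerInvariant G ρ γ D H clock (b + 1)
      (st.1 \ ancOf G st.1 B, st.2.1 ∪ L.1, st.2.2 + L.2 + ρ) := by
  intro L
  have hsub : ancOf G st.1 B ⊆ st.1 := ancOf_subset
  have hdiff : H \ (st.1 \ ancOf G st.1 B) = H \ st.1 ∪ ancOf G st.1 B := by
    ext u
    have h1 := @h.subset u
    have h2 := @hsub u
    simp only [mem_sdiff, mem_union]
    tauto
  have hcard : #(H \ (st.1 \ ancOf G st.1 B)) = #(H \ st.1) + #(ancOf G st.1 B) := by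
    rw [hdiff, card_union_of_disjoint]
    exact disjoint_left.2 fun u hu hu' => (mem_sdiff.1 hu).2 (hsub hu')
  obtain ⟨h1, h2⟩ := h.schedule.add_batch (D' := D ∪ ↑(H \ (st.1 \ ancOf G st.1 B))) hG h.closed
    (fun v hv => (card_le_card (anc_mono h.subset)).trans (hH v (h.subset hv))) B hB.mem (by
      rw [hdiff, coe_union, Set.union_assoc])
  refine ⟨sdiff_subset.trans h.subset, fun v hv u huv => ?_, h1, fun v hv => ?_, ?_⟩
  · rcases h.closed v (mem_sdiff.1 hv).1 u huv with hu | hu | hu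
    · by_cases huB : u ∈ ancOf G st.1 B
      · exact .inr (.inr (by rw [hdiff]; simp [huB]))
      · exact .inl (mem_sdiff.2 ⟨hu, huB⟩)
    · exact .inr (.inl hu)
    · exact .inr (.inr (by rw [hdiff, coe_union]; exact .inl hu))
  · obtain ⟨hvS, hvB⟩ := mem_sdiff.1 hv
    have h3 := ((hshrunk v hvS).resolve_left hvB).potential_le hγ hγ1
    refine h3.trans ?_
    rw [pow_succ', mul_assoc (4 * γ)]
    exact mul_le_mul_of_nonneg_left (h.potential v hvS) (by linarith)
  · have h3 : (M : ℝ) * L.2 ≤ (B.map fun v => #(anc G st.1 v)).sum + M * (2 * ρ) := by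
      exact_mod_cast h2
    have h4 := mul_le_mul_of_nonneg_left h3 hγ.le
    have h5 := hB.weight
    have h6 := h.clock_le
    simp only [hcard]
    simp only [Nat.cast_add, Nat.cast_one]
    linarith

variable [Fintype V] {cfg : Config V} {δ : ℝ≥0∞}

/-- After β batches a surviving job would have potential below the minimum 4γ, so none survives. The
count n used for the failure bound comes from the shrinking vertex set instead. -/
theorem scheduleSmallSubgraph_spec (hG : Acyclic G) (hγ : 0 < γ) (hγ1 : 4 * γ < 1) (hρ : 0 < ρ)
    (hβ : (4 * γ) ^ β * (8 * (ρ : ℝ) ^ 3) < 4 * γ) (hest : EstimatesAccurate cfg G δ) {fuel : ℕ}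
    (hfuel : Fintype.card V ≤ fuel) {D : Set V} (hclosed : ∀ v ∈ H, ∀ u, G.Adj u v → u ∈ H ∨ u ∈ D)
    (hH : ∀ v ∈ H, #(anc G H v) ≤ 2 * ρ) {σ : Schedule V M} {clock : ℕ}
    (hσ : IsPartialSchedule G ρ D σ clock) :
    HoldsExcept (scheduleSmallSubgraph cfg G M ρ γ fuel H σ clock)
      (Fintype.card V * (Fintype.card V * (4 * δ))) fun r =>
        IsPartialSchedule G ρ (D ∪ ↑H) r.1 r.2 ∧
          γ * (M * r.2) ≤ γ * (M * clock) + #H + γ * (M * (3 * ρ * β)) := by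
  have hle : #H ≤ Fintype.card V := card_le_univ H
  refine ((HoldsExcept.whileLoop (δ := Fintype.card V * (4 * δ))
    (fun st => ∃ b ≤ β, LayerInvariant G ρ γ D H clock b st) (fun st => #st.1)
    (fun st _ hc => card_pos.2 hc) ?_ fuel (H, σ, clock) ⟨0, Nat.zero_le _, ?_⟩
    (hle.trans hfuel)).bind (δ' := 0) fun r hr => HoldsExcept.pure ?_).mono ?_ fun _ h => h
  · rintro st ⟨b, hb, hst⟩ ⟨v, hv⟩
    have hbβ : b < β := by
      refine lt_of_le_of_ne hb fun hbβ => ?_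
      subst hbβ
      exact absurd ((le_potential hγ hγ1 hv).trans (hst.potential v hv)) (not_le.2 hβ)
    refine ((findBatch_spec (S := st.1) hγ.le hest hfuel).bind (δ' := 0) fun B hB =>
      HoldsExcept.pure ⟨⟨b + 1, hbβ, hst.step hG hγ hγ1 hH hB.1 hB.2⟩, ?_⟩).mono (by simp)
        fun _ h => h
    refine card_lt_card ⟨sdiff_subset, fun hsub => ?_⟩
    have hempty : ancOf G st.1 B = ∅ := eq_empty_of_forall_notMem fun u hu =>
      (mem_sdiff.1 (hsub (ancOf_subset hu))).2 hu
    rcases hB.2 v hv with h | h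
    · rw [hempty] at h
      exact notMem_empty _ h
    · exact not_shrunk hγ1 hempty hv h
  · refine ⟨subset_rfl, ?_, ?_, fun v hv => ?_, ?_⟩
    · simpa using hclosed
    · simpa using hσ
    · simpa using potential_le hγ1 hρ (hH v hv)
    · simp
  · obtain ⟨⟨b, hb, hr⟩, hc⟩ := hr
    have hempty : r.1 = ∅ := not_nonempty_iff_eq_empty.1 hc
    have h1 := hr.schedule
    have h2 := hr.clock_le
    rw [hempty, sdiff_empty] at h1 h2
    refine ⟨h1, h2.trans ?_⟩
    gcongr
  · rw [add_zero]
    gcongr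

theorem scheduleLayers_spec (hG : Acyclic G) (hγ : 0 < γ) (hγ1 : 4 * γ < 1) (hρ : 0 < ρ)
    (hβ : (4 * γ) ^ β * (8 * (ρ : ℝ) ^ 3) < 4 * γ) (hest : EstimatesAccurate cfg G δ) {fuel : ℕ}
    (hfuel : Fintype.card V ≤ fuel) :
    ∀ (Hs : List (Finset V)) (D : Finset V) (st : Schedule V M × ℕ), Layered G ρ D Hs →
      IsPartialSchedule G ρ ↑D st.1 st.2 →
      HoldsExcept (Hs.foldlM (fun (st : Schedule V M × ℕ) H =>
          scheduleSmallSubgraph cfg G M ρ γ fuel H st.1 st.2) st)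
        (Hs.length * (Fintype.card V * (Fintype.card V * (4 * δ)))) fun r =>
          IsPartialSchedule G ρ ↑(Hs.foldl (· ∪ ·) D) r.1 r.2 ∧
            γ * (M * r.2) ≤ γ * (M * st.2) + (Hs.map card).sum +
              γ * (M * (3 * ρ * β * Hs.length)) := by
  intro Hs
  induction Hs with
  | nil => exact fun D st _ h => (HoldsExcept.pure ⟨h, by simp⟩).mono (by simp) fun _ h => h
  | cons H Hs ih =>
    intro D st hL h
    rw [List.foldlM_cons]
    refine ((scheduleSmallSubgraph_spec hG hγ hγ1 hρ hβ hest hfuel hL.1 hL.2.1 h).bind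
      fun r hr => ih (D ∪ H) r hL.2.2 (by rw [coe_union]; exact hr.1)
        |>.mono le_rfl fun r' hr' => ⟨hr'.1, ?_⟩).mono (le_of_eq ?_) fun _ h => h
    · simp only [List.length_cons]
      push_cast
      ring
    · have h1 := hr.2
      have h2 := hr'.2
      simp only [List.map_cons, List.sum_cons, List.length_cons, Nat.cast_add, Nat.cast_one]
      linarith

/-- The algorithm outputs a feasible schedule whose length is compared with any other one. -/
theorem scheduleGeneralGraph_spec (hG : Acyclic G) (hγ : 0 < γ) (hγ1 : 4 * γ < 1) (hρ : 0 < ρ)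
    (hβ : (4 * γ) ^ β * (8 * (ρ : ℝ) ^ 3) < 4 * γ) (hest : EstimatesAccurate cfg G δ) {fuel : ℕ}
    (hfuel : (Fintype.card V + 1) * Fintype.card V + Fintype.card V ≤ fuel) :
    HoldsExcept (scheduleGeneralGraph cfg G M ρ γ fuel)
      (Fintype.card V * δ + Fintype.card V * (Fintype.card V * (Fintype.card V * (4 * δ))))
      fun σ => IsFeasible G ρ σ ∧ ∀ σ' : Schedule V M, IsFeasible G ρ σ' →
        (makespan σ : ℝ) ≤ (1 / γ + 3 * β) * (makespan σ' + ρ) := by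
  refine (partitionGraph_spec hG hρ hest hfuel).bind fun Hs hHs => ?_
  have hfuel' : Fintype.card V ≤ fuel := le_trans (by omega) hfuel
  refine ((scheduleLayers_spec (M := M) hG hγ hγ1 hρ hβ hest hfuel' Hs ∅ (∅, 0) hHs.layered
    ⟨by simp, by simp, by simp, by simp⟩).bind (δ' := 0) fun r hr =>
      HoldsExcept.pure ?_).mono ?_ fun _ h => h
  · obtain ⟨h1, h2⟩ := hr
    rw [hHs.cover, sdiff_empty, coe_univ] at h1
    refine ⟨h1.isFeasible, fun σ' hσ' => ?_⟩
    have hM : (0 : ℝ) < M := by exact_mod_cast Nat.pos_of_ne_zero (NeZero.ne M)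
    have h3 : ((Hs.map card).sum : ℝ) ≤ M * makespan σ' := by
      have := hHs.sum_card
      have := hσ'.card_le
      exact_mod_cast (by omega : (Hs.map card).sum ≤ M * makespan σ')
    have h4 : (Hs.length : ℝ) * ρ ≤ makespan σ' + ρ := by exact_mod_cast hHs.length_mul M σ' hσ'
    have h5 : (makespan r.1 : ℝ) ≤ r.2 := by exact_mod_cast h1.makespan_le
    have h6 : γ * (M * (3 * ρ * β * Hs.length)) ≤ γ * (M * (3 * β * (makespan σ' + ρ))) := by
      have : (3 * ρ * β * Hs.length : ℝ) = 3 * β * (Hs.length * ρ) := by ring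
      rw [this]
      gcongr
    have h7 : (M : ℝ) * (γ * r.2) ≤ M * (makespan σ' + γ * (3 * β * (makespan σ' + ρ))) := by
      simp only [Nat.cast_zero, mul_zero, zero_add] at h2
      linarith
    have h8 := le_of_mul_le_mul_left h7 hM
    have h9 : (makespan r.1 : ℝ) ≤ (makespan σ' + γ * (3 * β * (makespan σ' + ρ))) / γ := by
      rw [le_div_iff₀ hγ]
      nlinarith
    refine h9.trans ?_
    have hρ0 : (0 : ℝ) ≤ ρ := Nat.cast_nonneg ρ
    rw [add_div, mul_div_cancel_left₀ _ hγ.ne', add_mul, div_mul_eq_mul_div, one_mul]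
    gcongr
    linarith
  · rw [add_zero]
    have := hHs.length_add
    gcongr
    omega

end Analysis

/-! ### Choice of the constants. -/

section Parameters

/-- The number of batches per layer. -/
theorem exists_batch_bound {ρ : ℕ} (hρ : 256 ≤ Real.log ρ) :
    ∃ β : ℕ, (4 * (1 / √(Real.log ρ))) ^ β * (8 * (ρ : ℝ) ^ 3) < 4 * (1 / √(Real.log ρ)) ∧
      1 / (1 / √(Real.log ρ)) + 3 * β ≤ 56 * (Real.log ρ / Real.log (Real.log ρ)) := by
  obtain ⟨x, hx⟩ : ∃ x, x = Real.log ρ := ⟨_, rfl⟩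
  rw [← hx] at hρ ⊢
  have hx0 : 0 < x := by linarith
  have hρ0 : (0 : ℝ) < ρ := by
    rcases Nat.eq_zero_or_pos ρ with h | h
    · simp [h] at hx
      linarith
    · exact_mod_cast h
  have hlog4 : 4 * Real.log 4 ≤ Real.log x := by
    have h1 : Real.log ((4 : ℝ) ^ 4) ≤ Real.log x :=
      Real.log_le_log (by norm_num) (by norm_num; linarith)
    rw [Real.log_pow] at h1
    exact_mod_cast h1
  have hlog4pos : 0 < Real.log 4 := Real.log_pos (by norm_num)
  have hlogx : 0 < Real.log x := by linarith
  have hsqrt : 0 < √x := Real.sqrt_pos.2 hx0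
  set u := Real.log x / 2 - Real.log 4 with hu
  -- Here 4γ = exp(-u) with u = ln(x)/2 - ln 4, and x ≥ 256 = 4⁴ makes ln 4 at most a quarter of ln
  -- x.
  have hu4 : Real.log x / 4 ≤ u := by linarith
  have hq : 4 * (1 / √x) = Real.exp (-u) := by
    rw [hu, neg_sub, Real.exp_sub, Real.exp_log (by norm_num), ← Real.log_sqrt hx0.le,
      Real.exp_log hsqrt]
    ring
  have h8 : 8 * (ρ : ℝ) ^ 3 ≤ Real.exp (4 * x) := by
    have h1 : (ρ : ℝ) = Real.exp x := by rw [hx, Real.exp_log hρ0]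
    have h2 : (8 : ℝ) ≤ Real.exp x := by linarith [Real.add_one_le_exp x]
    calc 8 * (ρ : ℝ) ^ 3 ≤ Real.exp x * Real.exp x ^ 3 := by rw [h1]; gcongr
      _ = Real.exp (4 * x) := by
        rw [← pow_succ', ← Real.exp_nat_mul]
        norm_num
  set b := ⌊16 * x / Real.log x⌋₊ + 1 with hb
  have hb1 : 16 * x / Real.log x < b := by
    rw [hb]
    push_cast
    exact Nat.lt_floor_add_one _
  have hb2 : (b : ℝ) ≤ 16 * x / Real.log x + 1 := by
    rw [hb]
    push_cast
    linarith [Nat.floor_le (a := 16 * x / Real.log x) (by positivity)]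
  -- Since b · u > 4x and 8ρ³ ≤ exp(4x), `b` factors bring the potential below 1; the extra one
  -- brings it below 4γ. With X = x / ln x ≥ 1 the total is at most 2X + 3(16X + 2) ≤ 56X.
  refine ⟨b + 1, ?_, ?_⟩
  · rw [hq, pow_succ', mul_assoc]
    refine mul_lt_of_lt_one_right (Real.exp_pos _) ?_
    rw [← Real.exp_nat_mul]
    refine (mul_le_mul_of_nonneg_left h8 (Real.exp_pos _).le).trans_lt ?_
    rw [← Real.exp_add, Real.exp_lt_one_iff]
    rw [div_lt_iff₀ hlogx] at hb1
    have : (b : ℝ) * (Real.log x / 4) ≤ b * u := by gcongr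
    linarith
  · have h1 : √x ≤ 2 * (x / Real.log x) := by
      rw [mul_div_assoc', le_div_iff₀ hlogx]
      have h2 : Real.log x ≤ 2 * √x := by
        have := Real.log_le_sub_one_of_pos hsqrt
        rw [Real.log_sqrt hx0.le] at this
        linarith
      have h3 := Real.mul_self_sqrt hx0.le
      nlinarith
    have h2 : 1 ≤ x / Real.log x := by
      rw [one_le_div hlogx]
      linarith [Real.log_le_sub_one_of_pos hx0]
    rw [one_div_one_div]
    push_cast
    rw [mul_div_assoc] at hb2
    linarith

/-- The left side is (n² + 4n⁴)(2/3)^k ≤ n⁷(2/3)^k. As 2/3 ≤ exp(-1/3) and k ≥ 3(d + 7) ln n, the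
power is at most n^(-(d+7)). -/
theorem error_le {n : ℕ} (hn : 2 ≤ n) {d c' : ℝ} (hc' : 3 * (d + 7) ≤ c') :
    (n : ℝ≥0∞) * (n * ENNReal.ofReal ((2 / 3) ^ logCount c' n)) +
      n * (n * (n * (4 * (n * ENNReal.ofReal ((2 / 3) ^ logCount c' n))))) ≤
      ENNReal.ofReal (1 / (n : ℝ) ^ d) := by
  set k := logCount c' n with hk
  have hnR : (2 : ℝ) ≤ n := by exact_mod_cast hn
  have hn0 : (0 : ℝ) < n := by linarith
  have hlog : 0 ≤ Real.log n := Real.log_nonneg (by linarith)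
  have hkle : c' * Real.log n ≤ k := by
    rw [hk, logCount, Nat.cast_max]
    exact (Nat.le_ceil _).trans (le_max_right _ _)
  have hp : ((2 : ℝ) / 3) ^ k ≤ (n : ℝ) ^ (-(d + 7)) := by
    have h1 : (2 : ℝ) / 3 ≤ Real.exp (-(1 / 3)) := by
      linarith [Real.add_one_le_exp (-(1 / 3) : ℝ)]
    calc ((2 : ℝ) / 3) ^ k ≤ Real.exp (-(1 / 3)) ^ k := by gcongr
      _ = Real.exp (k * (-(1 / 3))) := by rw [← Real.exp_nat_mul]
      _ ≤ Real.exp (Real.log n * -(d + 7)) := by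
        refine Real.exp_le_exp.2 ?_
        nlinarith
      _ = (n : ℝ) ^ (-(d + 7)) := by rw [Real.rpow_def_of_pos hn0]
  have hreal : (n : ℝ) * (n * (2 / 3) ^ k) + n * (n * (n * (4 * (n * (2 / 3) ^ k)))) ≤
      1 / (n : ℝ) ^ d := by
    have h1 : (n : ℝ) * (n * (2 / 3) ^ k) + n * (n * (n * (4 * (n * (2 / 3) ^ k)))) ≤
        (n : ℝ) ^ 7 * (2 / 3) ^ k := by
      have h2 : (n : ℝ) ^ 2 + 4 * n ^ 4 ≤ n ^ 7 := by
        have h3 : (8 : ℝ) ≤ n ^ 3 := by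
          calc (8 : ℝ) = 2 ^ 3 := by norm_num
            _ ≤ n ^ 3 := by gcongr
        have h4 : (1 : ℝ) ≤ n ^ 2 := one_le_pow₀ (by linarith)
        nlinarith [mul_le_mul_of_nonneg_left h3 (by positivity : (0 : ℝ) ≤ (n : ℝ) ^ 4),
          mul_le_mul_of_nonneg_left h4 (by positivity : (0 : ℝ) ≤ (n : ℝ) ^ 2)]
      have := mul_le_mul_of_nonneg_right h2 (by positivity : (0 : ℝ) ≤ (2 / 3) ^ k)
      linarith
    refine h1.trans ?_
    calc (n : ℝ) ^ 7 * (2 / 3) ^ k ≤ (n : ℝ) ^ 7 * (n : ℝ) ^ (-(d + 7)) := by gcongr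
      _ = 1 / (n : ℝ) ^ d := by
        rw [← Real.rpow_natCast, ← Real.rpow_add hn0, one_div, ← Real.rpow_neg hn0.le]
        congr 1
        push_cast
        ring
  refine le_trans (le_of_eq ?_) (ENNReal.ofReal_le_ofReal hreal)
  have hp0 : (0 : ℝ) ≤ (2 / 3) ^ k := by positivity
  rw [ENNReal.ofReal_add (by positivity) (by positivity), ENNReal.ofReal_mul (by positivity),
    ENNReal.ofReal_mul (by positivity), ENNReal.ofReal_mul (by positivity),
    ENNReal.ofReal_mul (by positivity), ENNReal.ofReal_mul (by positivity),
    ENNReal.ofReal_mul (by positivity), ENNReal.ofReal_mul (by positivity),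
    ENNReal.ofReal_natCast, ENNReal.ofReal_ofNat]

theorem le_treeSize {c : ℝ} (hc : 34 ≤ c) : 300 ≤ treeSize c := by
  have h : (300 : ℝ) ≤ treeSize c := by
    refine le_trans ?_ (Nat.le_ceil _)
    rw [eps]
    norm_num
    linarith
  exact_mod_cast h

/-- Accurate estimates except with probability `δ` imply the approximation guarantee. -/
theorem le_outputProb_scheduleGeneralGraph {V : Type*} [Fintype V] [DecidableEq V] {cfg : Config V}
    {G : Digraph V} (hG : Acyclic G) {δ : ℝ≥0∞} (hest : EstimatesAccurate cfg G δ) (M : ℕ)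
    [NeZero M] {ρ : ℕ} (hρ : 256 ≤ Real.log ρ) :
    1 - (Fintype.card V * δ + Fintype.card V * (Fintype.card V * (Fintype.card V * (4 * δ)))) ≤
      outputProb (fun fuel => scheduleGeneralGraph cfg G M ρ (1 / √(Real.log ρ)) fuel)
        {σ | IsFeasible G ρ σ ∧ (makespan σ : ℝ) ≤
          56 * (Real.log ρ / Real.log (Real.log ρ)) * ((OPT G M ρ : ℝ) + ρ)} := by
  obtain ⟨β, hβ, hβ'⟩ := exists_batch_bound hρ
  have hρ0 : 0 < ρ := by
    rcases Nat.eq_zero_or_pos ρ with h | h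
    · simp [h] at hρ
      norm_num at hρ
    · exact h
  have hsqrt : (16 : ℝ) ≤ √(Real.log ρ) := Real.le_sqrt_of_sq_le (by norm_num; linarith)
  have hγ : 0 < 1 / √(Real.log ρ) := by positivity
  have hγ1 : 4 * (1 / √(Real.log ρ)) < 1 := by
    rw [mul_one_div, div_lt_one (by linarith)]
    linarith
  refine le_outputProb _ ((scheduleGeneralGraph_spec hG hγ hγ1 hρ0 hβ hest le_rfl).mono le_rfl
    fun σ hσ => ⟨hσ.1, ?_⟩)
  -- The output itself shows that feasible schedules exist, so the infimum is attained and is not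
  -- the default value of `sInf ∅`.
  obtain ⟨σ', hσ', hopt⟩ : ∃ σ' : Schedule V M, IsFeasible G ρ σ' ∧ makespan σ' = OPT G M ρ :=
    Nat.sInf_mem (s := {T | ∃ σ : Schedule V M, IsFeasible G ρ σ ∧ makespan σ = T})
      ⟨_, σ, hσ.1, rfl⟩
  rw [← hopt]
  exact (hσ.2 σ' hσ').trans (by gcongr)

end Parameters

end CommDelay

theorem mainTheorem2 :
    ∃ c₀ C : ℝ, ∃ ρ₀ : ℕ, ∀ c : ℝ, c₀ ≤ c → ∀ d : ℝ, 1 ≤ d → ∃ c'₀ : ℝ, ∀ c' : ℝ, c'₀ ≤ c' →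
      ∀ a : ℝ, 0 < a →
      ∀ (V : Type*) [Fintype V] [DecidableEq V] (G : Digraph V), CommDelay.Acyclic G →
      ∀ (hashV : CommDelay.TwoUniversalFamily V (Fintype.card V ^ 3))
        (hashE : CommDelay.TwoUniversalFamily (V × V) (Fintype.card (V × V) ^ 3))
        (M : ℕ) [NeZero M] (ρ : ℕ), ρ₀ ≤ ρ →
        ENNReal.ofReal (1 - 1 / (Fintype.card V : ℝ) ^ d) ≤
          CommDelay.outputProb
            (fun fuel => CommDelay.scheduleGeneralGraph ⟨c, c', a, hashV, hashE⟩ G M ρ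
              (1 / √(Real.log ρ)) fuel)
            {σ | CommDelay.IsFeasible G ρ σ ∧
              (CommDelay.makespan σ : ℝ) ≤
                C * (Real.log ρ / Real.log (Real.log ρ)) * ((CommDelay.OPT G M ρ : ℝ) + ρ)} := by
  refine ⟨34, 56, ⌈Real.exp 256⌉₊, fun c hc d hd => ⟨3 * (d + 7), fun c' hc' a _ V _ _ G hG hashV
    hashE M _ ρ hρ => ?_⟩⟩
  have hlog : 256 ≤ Real.log ρ := by
    have h1 : Real.exp 256 ≤ ρ := (Nat.le_ceil _).trans (by exact_mod_cast hρ)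
    rw [← Real.log_exp 256]
    exact Real.log_le_log (Real.exp_pos _) h1
  -- For n = 1 the claimed probability is 0. For n = 0 the convention 1/0 = 0 demands probability 1,
  -- and the estimates are vacuously accurate.
  rcases subsingleton_or_nontrivial V with hV | hV
  · rcases isEmpty_or_nonempty V with hV' | hV'
    · refine le_trans ?_ (CommDelay.le_outputProb_scheduleGeneralGraph (δ := 0) hG
        ⟨fun S => CommDelay.HoldsExcept.lift (by simp),
          fun S => CommDelay.HoldsExcept.lift (by simp)⟩ M hlog)
      simp [Real.rpow_nonneg]
    · have : Fintype.card V = 1 :=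
        le_antisymm (Fintype.card_le_one_iff_subsingleton.2 hV) Fintype.card_pos
      simp [this]
  · refine le_trans ?_ (CommDelay.le_outputProb_scheduleGeneralGraph hG
      ⟨CommDelay.estimateV_accurate hV (CommDelay.le_treeSize hc) hG,
        CommDelay.estimateE_accurate hV (CommDelay.le_treeSize hc) hG⟩ M hlog)
    rw [ENNReal.ofReal_sub _ (by positivity), ENNReal.ofReal_one]
    exact tsub_le_tsub_left (CommDelay.error_le Fintype.one_lt_card hc') 1
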